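/- For a connected simple graph $G$ on $n$ vertices let $D(G)=(d_G(u,v))_{u,v\in V(G)}$ be its distance matrix, let $Tr(G)$ be the diagonal matrix whose $v$-th diagonal entry is the transmission $\sum_{w\in V(G)} d_G(v,w)$, and let $\partial^Q_1(G)$ be the largest eigenvalue of the distance signless Laplacian matrix $\mathcal{Q}(G)=Tr(G)+D(G)$. Let the kite $Ki_{n,3}$ be the graph on $n$ vertices obtained from a triangle $C_3$ and a path $P_{n-3}$ by adding an edge between an endpoint of the path and a vertex of the triangle. A graph is unicyclic if it contains exactly one cycle. Theorem. Let $G$ be a connected unicyclic graph on $n\ge 6$ vertices. Then $$\partial^Q_1(G)\le \partial^Q_1(Ki_{n,3}),$$ with equality if and only if $G\cong Ki_{n,3}$. -/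

import Mathlib

/-- `G` is unicyclic: it contains exactly one cycle (cycles being regarded as subgraphs of `G`, so
that neither the base point nor the orientation of a closed walk matters). -/
def SimpleGraph.IsUnicyclic {V : Type*} (G : SimpleGraph V) : Prop :=
  ∃! C : G.Subgraph, ∃ (v : V) (c : G.Walk v v), c.IsCycle ∧ c.toSubgraph = C

/-- The distance matrix `D(G)`. -/
noncomputable def SimpleGraph.distanceMatrix {V : Type*} (G : SimpleGraph V) : Matrix V V ℝ :=
  Matrix.of fun u v => (G.dist u v : ℝ)

/-- The transmission `Tr(v)` of a vertex: the sum of its distances to all the vertices. -/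
noncomputable def SimpleGraph.transmission {V : Type*} [Fintype V] (G : SimpleGraph V) (v : V) :
    ℝ :=
  ∑ w, (G.dist v w : ℝ)

/-- The distance signless Laplacian matrix `Q(G) = Tr(G) + D(G)`. -/
noncomputable def SimpleGraph.distanceSignlessLaplacian {V : Type*} [Fintype V] [DecidableEq V]
    (G : SimpleGraph V) : Matrix V V ℝ :=
  Matrix.diagonal G.transmission + G.distanceMatrix

/-- The distance signless Laplacian spectral radius: the largest eigenvalue of `Q(G)`
(see `SimpleGraph.isGreatest_distanceSignlessLaplacianRadius`). -/
noncomputable def SimpleGraph.distanceSignlessLaplacianRadius {V : Type*} [Fintype V]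
    [DecidableEq V] (G : SimpleGraph V) : ℝ :=
  sSup (spectrum ℝ G.distanceSignlessLaplacian)

theorem SimpleGraph.isHermitian_distanceSignlessLaplacian {V : Type*} [Fintype V] [DecidableEq V]
    (G : SimpleGraph V) : G.distanceSignlessLaplacian.IsHermitian := by
  refine (Matrix.isHermitian_diagonal _).add ?_
  ext u v
  simp [SimpleGraph.distanceMatrix, SimpleGraph.dist_comm]

theorem SimpleGraph.isGreatest_distanceSignlessLaplacianRadius {V : Type*} [Fintype V]
    [DecidableEq V] [Nonempty V] (G : SimpleGraph V) :
    IsGreatest (spectrum ℝ G.distanceSignlessLaplacian) G.distanceSignlessLaplacianRadius := by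
  have h : spectrum ℝ G.distanceSignlessLaplacian =
      Set.range G.isHermitian_distanceSignlessLaplacian.eigenvalues :=
    G.isHermitian_distanceSignlessLaplacian.spectrum_real_eq_range_eigenvalues
  have hf : (spectrum ℝ G.distanceSignlessLaplacian).Finite := h ▸ Set.finite_range _
  have hn : (spectrum ℝ G.distanceSignlessLaplacian).Nonempty := h ▸ Set.range_nonempty _
  exact ⟨hn.csSup_mem hf, fun _ hx => le_csSup hf.bddAbove hx⟩

/-- The kite `Ki_{n,3}` (for `n ≥ 3`) on the vertices `0, …, n - 1`: the triangle `0, 1, 2`, the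
path `3, 4, …, n - 1`, and the edge joining the vertex `2` of the triangle to the endpoint `3` of
the path. The first disjunct contributes the edges `01`, `12`, `23`, …, the second the
edge `02`. -/
def SimpleGraph.kite (n : ℕ) : SimpleGraph (Fin n) :=
  SimpleGraph.fromRel fun i j => i.val + 1 = j.val ∨ (i.val = 0 ∧ j.val = 2)

/-!
Twice the quadratic form of the distance signless Laplacian of `G` at `x` is the *energy*
`∑ u, ∑ w, d(u, w) (x u + x w) ^ 2`. Among the finitely many connected graphs on `V` that contain a
cycle, choose one, `G`, whose spectral radius is largest, and let `x > 0` be its Perron vector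
(`exists_pos_distEnergy_eq`). By the Rayleigh principle `G` also maximizes the energy at this fixed
`x` (`exists_isEnergyMax`). Hence no combination of modifications of `G` that stay connected and
cyclic can change all distances by a total that is nonnegative for every pair and positive for some
pair (`IsEnergyMax.false_of_nonneg_of_pos`). It remains to see that a maximizer is a kite; a
unicyclic graph is one of the competitors, so both the inequality and the equality case follow.
New distances need only be bounded from below, for which a function that is Lipschitz along the
edges suffices (`le_add_dist_of_lipschitz`); old ones only from above.

* `G` is a cycle with rooted trees attached, since other edges could be removed
  (`IsEnergyMax.exists_cycleForest`).
* If `v` had two children `b₁`, `b₂`, all edges from `v` to the rest of the graph could be redirected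
  to `b₁` or to `b₂`. The changes on the two branches cancel, and `v` moves away from the rest
  (`IsEnergyMax.false_of_branches`). So the trees are paths, and `G` is a cycle of length `g` with a
  path (a *block*) rooted at each cycle vertex (`IsEnergyMax.exists_cycleTails`).
* Both cycle neighbours of a vertex cannot have nontrivial blocks: the block of that vertex could be
  made to form a triangle with the beginning of either of the two paths (`CycleTails.false_of_pend`).
  For `g = 3` this leaves only the kite (`CycleTails.nonempty_iso_kite`).
* For `g ≥ 4`, the cycle can be cut next to a vertex `i`, a chord making a triangle of `i` and the
  next two vertices. Using both directions, the only losses are between `i` and the cycle vertices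
  farthest from `i`. For odd `g` the sum over all `i` is a gain (`CycleTails.false_of_odd`). For even
  `g ≥ 6`, the loss between the block of `i` and the antipodal one exceeds the gain for every other
  block, the neighbours of the antipode aside. Comparing two trivial blocks in this way from both of
  their antipodes gives `x y < x z` and `x z < x y`, so two trivial blocks are adjacent or antipodal
  (`CycleTails.not_trivial_and_trivial`), which is incompatible with the previous item
  (`CycleTails.false_of_even`).
* For `g = 4` at most two blocks, adjacent ones, are nontrivial. Two of them are excluded by comparing
  the Perron entries at the other two cycle vertices in both orders (`CycleTails.lt_of_four`). If
  there is only one, it is a path with at least two vertices off the cycle, as `n ≥ 6`, and a cycle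
  neighbour of its root can be moved up that path (`CycleTails.sq_lt_of_four`).
-/

namespace SimpleGraph

open Matrix

variable {V : Type*} [Fintype V]

/-! ### The quadratic form and the Perron vector -/

/-- The quadratic form `2 xᵀ Q(G) x`, written as a sum over ordered pairs of vertices. -/
noncomputable def distEnergy (G : SimpleGraph V) (x : V → ℝ) : ℝ :=
  ∑ u, ∑ w, (G.dist u w : ℝ) * (x u + x w) ^ 2

section Spectral

variable [DecidableEq V]

theorem distanceSignlessLaplacian_mulVec_apply (G : SimpleGraph V) (y : V → ℝ) (u : V) :
    (G.distanceSignlessLaplacian *ᵥ y) u = ∑ w, (G.dist u w : ℝ) * (y u + y w) := by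
  simp [distanceSignlessLaplacian, transmission, distanceMatrix,
    mulVec, dotProduct, Matrix.diagonal_apply, Finset.sum_add_distrib, mul_add, Finset.sum_mul,
    add_mul]

theorem dotProduct_distanceSignlessLaplacian_mulVec (G : SimpleGraph V) (y : V → ℝ) :
    2 * (y ⬝ᵥ G.distanceSignlessLaplacian *ᵥ y) = G.distEnergy y := by
  have h1 : y ⬝ᵥ G.distanceSignlessLaplacian *ᵥ y =
      ∑ u, ∑ w, (G.dist u w : ℝ) * (y u * y u + y u * y w) := by
    simp only [dotProduct, distanceSignlessLaplacian_mulVec_apply, Finset.mul_sum]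
    exact Finset.sum_congr rfl fun u _ => Finset.sum_congr rfl fun w _ => by ring
  have h2 : y ⬝ᵥ G.distanceSignlessLaplacian *ᵥ y =
      ∑ u, ∑ w, (G.dist u w : ℝ) * (y w * y w + y w * y u) := by
    rw [h1, Finset.sum_comm]
    exact Finset.sum_congr rfl fun u _ => Finset.sum_congr rfl fun w _ => by rw [dist_comm]
  rw [two_mul]
  nth_rewrite 1 [h1]
  rw [h2, distEnergy, ← Finset.sum_add_distrib]
  refine Finset.sum_congr rfl fun u _ => ?_
  rw [← Finset.sum_add_distrib]
  exact Finset.sum_congr rfl fun w _ => by ring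

/-- `∂ I - Q(G)` is positive semidefinite, `∂` being the largest eigenvalue of `Q(G)`. -/
theorem posSemidef_radius_sub [Nonempty V] (G : SimpleGraph V) :
    (algebraMap ℝ (Matrix V V ℝ) G.distanceSignlessLaplacianRadius
      - G.distanceSignlessLaplacian).PosSemidef := by
  rw [posSemidef_iff_isHermitian_and_spectrum_nonneg]
  refine ⟨IsHermitian.sub ?_ G.isHermitian_distanceSignlessLaplacian, fun a ha => ?_⟩
  · rw [Matrix.algebraMap_eq_diagonal]
    exact isHermitian_diagonal _
  · rw [← spectrum.singleton_sub_eq, Set.singleton_sub] at ha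
    obtain ⟨b, hb, rfl⟩ := ha
    exact sub_nonneg.2 (G.isGreatest_distanceSignlessLaplacianRadius.2 hb)

theorem dotProduct_radius_sub_mulVec (G : SimpleGraph V) (y : V → ℝ) :
    2 * (star y ⬝ᵥ (algebraMap ℝ (Matrix V V ℝ) G.distanceSignlessLaplacianRadius
      - G.distanceSignlessLaplacian) *ᵥ y) =
      2 * G.distanceSignlessLaplacianRadius * (y ⬝ᵥ y) - G.distEnergy y := by
  rw [← dotProduct_distanceSignlessLaplacian_mulVec, sub_mulVec, dotProduct_sub,
    Algebra.algebraMap_eq_smul_one, smul_mulVec, one_mulVec, dotProduct_smul, star_trivial]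
  simp only [smul_eq_mul]
  ring

/-- The Rayleigh bound. -/
theorem distEnergy_le_radius [Nonempty V] (G : SimpleGraph V) (y : V → ℝ) :
    G.distEnergy y ≤ 2 * G.distanceSignlessLaplacianRadius * (y ⬝ᵥ y) := by
  have h := (posSemidef_iff_dotProduct_mulVec.1 G.posSemidef_radius_sub).2 y
  have h2 := G.dotProduct_radius_sub_mulVec y
  linarith

/-- A vector attaining the Rayleigh bound is an eigenvector. -/
theorem mulVec_eq_of_distEnergy_eq [Nonempty V] (G : SimpleGraph V) (y : V → ℝ)
    (h : 2 * G.distanceSignlessLaplacianRadius * (y ⬝ᵥ y) ≤ G.distEnergy y) :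
    G.distanceSignlessLaplacian *ᵥ y = G.distanceSignlessLaplacianRadius • y := by
  have h0 := (G.posSemidef_radius_sub.dotProduct_mulVec_zero_iff y).1 (by
    have h1 := (posSemidef_iff_dotProduct_mulVec.1 G.posSemidef_radius_sub).2 y
    have h2 := G.dotProduct_radius_sub_mulVec y
    linarith)
  rw [sub_mulVec, Algebra.algebraMap_eq_smul_one, smul_mulVec, one_mulVec, sub_eq_zero] at h0
  exact h0.symm

/-- The Perron vector: the absolute value of a top eigenvector is again a top eigenvector, and its
entries are positive because all distances between distinct vertices are. -/
theorem exists_pos_distEnergy_eq [Nontrivial V] (G : SimpleGraph V) (hG : G.Connected) :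
    ∃ x : V → ℝ, (∀ v, 0 < x v) ∧
      G.distEnergy x = 2 * G.distanceSignlessLaplacianRadius * (x ⬝ᵥ x) := by
  set r := G.distanceSignlessLaplacianRadius with hr
  have hmem := G.isGreatest_distanceSignlessLaplacianRadius.1
  rw [spectrum.mem_iff, Matrix.isUnit_iff_isUnit_det, isUnit_iff_ne_zero, not_not,
    ← exists_mulVec_eq_zero_iff] at hmem
  obtain ⟨y, hy0, hy⟩ := hmem
  have hyE : 2 * r * (y ⬝ᵥ y) = G.distEnergy y := by
    have h2 := G.dotProduct_radius_sub_mulVec y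
    rw [hy, dotProduct_zero] at h2
    linarith
  set z : V → ℝ := fun v => |y v| with hz
  have hzy : z ⬝ᵥ z = y ⬝ᵥ y := by simp [hz, dotProduct]
  have hle : G.distEnergy y ≤ G.distEnergy z := by
    refine Finset.sum_le_sum fun u _ => Finset.sum_le_sum fun w _ => ?_
    refine mul_le_mul_of_nonneg_left ?_ (Nat.cast_nonneg _)
    exact sq_le_sq' (by linarith [neg_abs_le (y u), neg_abs_le (y w)])
      (add_le_add (le_abs_self _) (le_abs_self _))
  have hzE : 2 * r * (z ⬝ᵥ z) ≤ G.distEnergy z := by rw [hzy, hyE]; exact hle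
  have heig := G.mulVec_eq_of_distEnergy_eq z hzE
  obtain ⟨v0, hv0⟩ : ∃ v, y v ≠ 0 := by
    by_contra! h
    exact hy0 (funext h)
  have hz0 : ∀ v, 0 ≤ z v := fun v => abs_nonneg _
  have hne : ∀ v, z v ≠ 0 := by
    intro v hv
    have h1 := congrFun heig v
    rw [distanceSignlessLaplacian_mulVec_apply, Pi.smul_apply, hv, smul_zero] at h1
    have h2 := (Finset.sum_eq_zero_iff_of_nonneg (fun w _ =>
      mul_nonneg (Nat.cast_nonneg _) (by rw [zero_add]; exact hz0 w))).1 h1 v0 (Finset.mem_univ _)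
    rw [zero_add] at h2
    rcases mul_eq_zero.1 h2 with h3 | h3
    · have : v = v0 := hG.dist_eq_zero_iff.1 (by exact_mod_cast h3)
      exact hv0 (by simpa [hz, this] using hv)
    · exact hv0 (by simpa [hz] using h3)
  exact ⟨z, fun v => lt_of_le_of_ne (hz0 v) (hne v).symm,
    le_antisymm (G.distEnergy_le_radius z) hzE⟩

end Spectral

/-! ### Extremal graphs -/

/-- `G` contains a cycle: distinct vertices `c i`, `i ∈ ℤ/g` with `g ≥ 3`, cyclically consecutive
ones being adjacent. -/
def HasCycle {V : Type*} (G : SimpleGraph V) : Prop :=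
  ∃ g : ℕ, 3 ≤ g ∧ ∃ c : ZMod g → V, Function.Injective c ∧ ∀ i, G.Adj (c i) (c (i + 1))

/-- `G` maximizes the quadratic form at the positive vector `x` among all connected graphs on `V`
that contain a cycle. -/
structure IsEnergyMax {V : Type*} [Fintype V] (G : SimpleGraph V) (x : V → ℝ) : Prop where
  pos : ∀ v, 0 < x v
  connected : G.Connected
  hasCycle : G.HasCycle
  le : ∀ G' : SimpleGraph V, G'.Connected → G'.HasCycle → G'.distEnergy x ≤ G.distEnergy x

/-- A maximizer of the spectral radius among connected graphs with a cycle is energy-maximal at its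
Perron vector. -/
theorem exists_isEnergyMax [DecidableEq V] [Nontrivial V] (G : SimpleGraph V) (hG : G.Connected)
    (hc : G.HasCycle)
    (hmax : ∀ G' : SimpleGraph V, G'.Connected → G'.HasCycle →
      G'.distanceSignlessLaplacianRadius ≤ G.distanceSignlessLaplacianRadius) :
    ∃ x, G.IsEnergyMax x := by
  obtain ⟨x, hx, hE⟩ := G.exists_pos_distEnergy_eq hG
  refine ⟨x, hx, hG, hc, fun G' h1 h2 => (G'.distEnergy_le_radius x).trans ?_⟩
  rw [hE]
  have : 0 ≤ x ⬝ᵥ x := Finset.sum_nonneg fun i _ => mul_self_nonneg _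
  have := hmax G' h1 h2
  gcongr

/-- The linear consequence of energy-maximality used throughout: if `E` bounds the change of all
distances from below when `G` is replaced by `G'`, then the energy of `E` is not positive. -/
theorem IsEnergyMax.sum_nonpos {G : SimpleGraph V} {x : V → ℝ} (h : G.IsEnergyMax x)
    {G' : SimpleGraph V} (h1 : G'.Connected) (h2 : G'.HasCycle) (E : V → V → ℤ)
    (hE : ∀ u w, E u w + G.dist u w ≤ G'.dist u w) :
    ∑ u, ∑ w, (E u w : ℝ) * (x u + x w) ^ 2 ≤ 0 := by
  have h3 := h.le G' h1 h2
  refine le_trans ?_ (sub_nonpos.2 h3)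
  simp only [distEnergy, ← Finset.sum_sub_distrib]
  refine Finset.sum_le_sum fun u _ => Finset.sum_le_sum fun w _ => ?_
  rw [← sub_mul]
  refine mul_le_mul_of_nonneg_right ?_ (sq_nonneg _)
  have := hE u w
  have h4 : ((E u w + G.dist u w : ℤ) : ℝ) ≤ ((G'.dist u w : ℤ) : ℝ) := by exact_mod_cast this
  push_cast at h4
  linarith

end SimpleGraph

namespace SimpleGraph

/-! ### Cycles, distances and connectedness -/

variable {V : Type*}

theorem val_add_one_eq_ite {g : ℕ} (hg : 2 ≤ g) (i : ZMod g) :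
    (i + 1).val = if i.val + 1 = g then 0 else i.val + 1 := by
  have : NeZero g := ⟨by omega⟩
  have : Fact (1 < g) := ⟨by omega⟩
  have hi := i.val_lt
  rw [ZMod.val_add, ZMod.val_one]
  split_ifs with h
  · rw [h, Nat.mod_self]
  · exact Nat.mod_eq_of_lt (by omega)

theorem Walk.IsCycle.hasCycle {G : SimpleGraph V} {v : V} {p : G.Walk v v} (hp : p.IsCycle) :
    G.HasCycle := by
  have h3 := hp.three_le_length
  have : NeZero p.length := ⟨by omega⟩
  refine ⟨p.length, h3, fun i => p.getVert (i.val + 1), fun i j hij => ?_, fun i => ?_⟩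
  · have hi := i.val_lt
    have hj := j.val_lt
    have := hp.getVert_injOn (x₁ := i.val + 1) (x₂ := j.val + 1) ⟨by omega, by omega⟩
      ⟨by omega, by omega⟩ hij
    exact ZMod.val_injective _ (by omega)
  · have hi := i.val_lt
    simp only [val_add_one_eq_ite (by omega : 2 ≤ p.length)]
    split_ifs with h
    · rw [h, p.getVert_length]
      simpa using p.adj_getVert_succ (i := 0) (by omega)
    · exact p.adj_getVert_succ (by omega)

theorem HasCycle.of_triangle {G : SimpleGraph V} {a b d : V} (h1 : G.Adj a b) (h2 : G.Adj b d)
    (h3 : G.Adj d a) : G.HasCycle := by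
  refine ⟨3, le_rfl, ![a, b, d], fun i j hij => ?_, fun i => ?_⟩
  · fin_cases i <;> fin_cases j <;> first | rfl | skip
    all_goals
      simp_all [h1.ne, h2.ne, h3.ne, h1.ne.symm, h2.ne.symm, h3.ne.symm]
  · fin_cases i
    exacts [h1, h2, h3]

/-- A function that changes by at most one along each edge bounds the distance from below. -/
theorem le_add_dist_of_lipschitz {G : SimpleGraph V} (hG : G.Connected) (φ : V → ℕ)
    (hφ : ∀ a b, G.Adj a b → φ b ≤ φ a + 1) (u w : V) : φ w ≤ φ u + G.dist u w := by
  obtain ⟨p, hp⟩ := hG.exists_walk_length_eq_dist u w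
  rw [← hp]
  clear hp
  induction p with
  | nil => simp
  | cons h p ih =>
    have := hφ _ _ h
    rw [Walk.length_cons]
    omega

/-- A graph is connected if every vertex but `b` has a neighbour of smaller rank. -/
theorem connected_of_rank {G : SimpleGraph V} (b : V) (ρ : V → ℕ)
    (h : ∀ u, u ≠ b → ∃ w, G.Adj u w ∧ ρ w < ρ u) : G.Connected := by
  have key : ∀ n u, ρ u = n → G.Reachable u b := by
    intro n
    induction n using Nat.strong_induction_on with
    | _ n ih =>
      intro u hu
      by_cases hub : u = b
      · rw [hub]
      · obtain ⟨w, hw, hlt⟩ := h u hub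
        exact hw.reachable.trans (ih _ (hu ▸ hlt) w rfl)
  have : Nonempty V := ⟨b⟩
  exact ⟨fun u w => (key _ u rfl).trans (key _ w rfl).symm⟩

theorem Connected.of_forall_adj_reachable {G G' : SimpleGraph V} (hG : G.Connected)
    (h : ∀ a b, G.Adj a b → G'.Reachable a b) : G'.Connected := by
  have := hG.nonempty
  refine ⟨fun u w => ?_⟩
  obtain ⟨p⟩ := hG.preconnected u w
  induction p with
  | nil => exact Reachable.refl _
  | cons hadj p ih => exact (h _ _ hadj).trans ih

theorem Connected.dist_le_succ_of_adj {G : SimpleGraph V} (hG : G.Connected) (u : V) {a b : V}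
    (h : G.Adj a b) : G.dist u b ≤ G.dist u a + 1 := by
  have := hG.dist_triangle (u := u) (v := a) (w := b)
  rwa [dist_eq_one_iff_adj.2 h] at this

/-! ### The forest hanging off a cycle -/

/-- `G` consists of the cycle `c` together with edges from each vertex `u` off the cycle to its
parent `p u`, where `dep u` is the distance from `u` to the cycle (and `p` fixes the cycle). -/
structure CycleForest (G : SimpleGraph V) (g : ℕ) (c : ZMod g → V) (p : V → V) (dep : V → ℕ) :
    Prop where
  three_le : 3 ≤ g
  inj : Function.Injective c
  dep_eq_zero : ∀ u, dep u = 0 ↔ ∃ i, u = c i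
  parent_of_dep : ∀ u, dep u = 0 → p u = u
  dep_parent : ∀ u, dep u ≠ 0 → dep (p u) + 1 = dep u
  adj : ∀ u w, G.Adj u w ↔ (dep u ≠ 0 ∧ w = p u) ∨ (dep w ≠ 0 ∧ u = p w) ∨
    (∃ i, u = c i ∧ w = c (i + 1)) ∨ ∃ i, w = c i ∧ u = c (i + 1)

/-- Breadth-first search from the set `c`: distances `dep` to the set, and a choice `p` of
predecessors. -/
theorem exists_dep {G : SimpleGraph V} (hG : G.Connected) {ι : Type*} [Nonempty ι] (c : ι → V) :
    ∃ (p : V → V) (dep : V → ℕ), (∀ u, dep u = 0 ↔ ∃ i, u = c i) ∧ (∀ u, dep u = 0 → p u = u) ∧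
      ∀ u, dep u ≠ 0 → dep (p u) + 1 = dep u ∧ G.Adj u (p u) := by
  classical
  have hex : ∀ u, ∃ k i, G.dist u (c i) = k := fun u => ⟨_, Classical.arbitrary ι, rfl⟩
  let dep : V → ℕ := fun u => Nat.find (hex u)
  have hdep : ∀ u, ∃ i, G.dist u (c i) = dep u := fun u => Nat.find_spec (hex u)
  have hle : ∀ u i, dep u ≤ G.dist u (c i) := fun u i => Nat.find_min' (hex u) ⟨i, rfl⟩
  have hstep : ∀ u, dep u ≠ 0 → ∃ w, dep w + 1 = dep u ∧ G.Adj u w := by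
    intro u hu
    obtain ⟨i, hi⟩ := hdep u
    obtain ⟨q, hq⟩ := hG.exists_walk_length_eq_dist u (c i)
    cases q with
    | nil => exact absurd (hi.symm.trans dist_self) hu
    | @cons _ w _ hadj q =>
      rw [Walk.length_cons] at hq
      have h1 := dist_le q
      have h2 := hle w i
      obtain ⟨j, hj⟩ := hdep w
      have h3 := hle u j
      have h4 := hG.dist_le_succ_of_adj (c j) hadj.symm
      rw [dist_comm, dist_comm (u := c j)] at h4
      exact ⟨w, by omega, hadj⟩
  choose! p hp using hstep
  refine ⟨fun u => if dep u = 0 then u else p u, dep, fun u => ?_, fun u hu => if_pos hu,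
    fun u hu => ?_⟩
  · constructor
    · intro h
      obtain ⟨i, hi⟩ := hdep u
      exact ⟨i, hG.dist_eq_zero_iff.1 (hi.trans h)⟩
    · rintro ⟨i, rfl⟩
      exact Nat.le_zero.1 ((hle (c i) i).trans_eq dist_self)
  · simpa only [if_neg hu] using hp u hu

variable [Fintype V]

/-- No combination of moves can change all distances by a nonnegative and some distance by a positive
amount. -/
theorem IsEnergyMax.false_of_nonneg_of_pos {G : SimpleGraph V} {x : V → ℝ} (h : G.IsEnergyMax x)
    {E : V → V → ℤ} (hs : ∑ u, ∑ w, (E u w : ℝ) * (x u + x w) ^ 2 ≤ 0) (h0 : ∀ u w, 0 ≤ E u w)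
    {a b : V} (hab : 0 < E a b) : False := by
  have hf : ∀ u w, 0 ≤ (E u w : ℝ) * (x u + x w) ^ 2 := fun u w =>
    mul_nonneg (by exact_mod_cast h0 u w) (sq_nonneg _)
  have h1 := (Finset.sum_eq_zero_iff_of_nonneg fun u _ => Finset.sum_nonneg fun w _ => hf u w).1
    (le_antisymm hs (Finset.sum_nonneg fun u _ => Finset.sum_nonneg fun w _ => hf u w)) a
    (Finset.mem_univ _)
  have h2 := (Finset.sum_eq_zero_iff_of_nonneg fun w _ => hf a w).1 h1 b (Finset.mem_univ _)
  have h3 : 0 < x a + x b := add_pos (h.pos a) (h.pos b)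
  have h4 : (0 : ℝ) < E a b := by exact_mod_cast hab
  have : 0 < (E a b : ℝ) * (x a + x b) ^ 2 := by positivity
  linarith

/-- Removing an edge while staying connected and cyclic increases distances, so an energy-maximal
graph is a cycle with trees attached. -/
theorem IsEnergyMax.exists_cycleForest {G : SimpleGraph V} {x : V → ℝ} (h : G.IsEnergyMax x) :
    ∃ g c p dep, CycleForest G g c p dep := by
  classical
  obtain ⟨g, hg, c, hinj, hc⟩ := h.hasCycle
  have : NeZero g := ⟨by omega⟩
  obtain ⟨p, dep, hd0, hpd, hpar⟩ := exists_dep h.connected c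
  let R : V → V → Prop := fun u w => (dep u ≠ 0 ∧ w = p u) ∨ (dep w ≠ 0 ∧ u = p w) ∨
    (∃ i, u = c i ∧ w = c (i + 1)) ∨ ∃ i, w = c i ∧ u = c (i + 1)
  have hRG : ∀ u w, R u w → G.Adj u w := by
    rintro u w (⟨h1, rfl⟩ | ⟨h1, rfl⟩ | ⟨i, rfl, rfl⟩ | ⟨i, rfl, rfl⟩)
    exacts [(hpar _ h1).2, (hpar _ h1).2.symm, hc i, (hc i).symm]
  let G' : SimpleGraph V :=
    { Adj := R
      symm := ⟨by
        rintro u w (h1 | h1 | h1 | h1)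
        exacts [Or.inr (Or.inl h1), Or.inl h1, Or.inr (Or.inr (Or.inr h1)),
          Or.inr (Or.inr (Or.inl h1))]⟩
      loopless := ⟨fun u hu => (hRG u u hu).ne rfl⟩ }
  have hle : G' ≤ G := fun u w => hRG u w
  have hconn : G'.Connected := by
    -- off the cycle the rank decreases with `dep`; on the cycle it is the index of the vertex
    refine connected_of_rank (c 0) (fun u => dep u * g + if hu : ∃ i, u = c i then
      hu.choose.val else 0) fun u hu => ?_
    by_cases h0 : dep u = 0
    · obtain ⟨i, rfl⟩ := (hd0 u).1 h0
      have hi0 : i ≠ 0 := fun h => hu (h ▸ rfl)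
      have hv : (i - 1).val + 1 = i.val := by
        have h1 := val_add_one_eq_ite (by omega : 2 ≤ g) (i - 1)
        rw [sub_add_cancel] at h1
        have h2 : i.val ≠ 0 := by rwa [Ne, ZMod.val_eq_zero]
        split_ifs at h1 <;> omega
      have hch : ∀ j, ∃ hj : ∃ k, c j = c k, hj.choose = j := fun j =>
        ⟨⟨j, rfl⟩, (hinj (Exists.choose_spec (⟨j, rfl⟩ : ∃ k, c j = c k))).symm⟩
      refine ⟨c (i - 1), Or.inr (Or.inr (Or.inr ⟨i - 1, rfl, by rw [sub_add_cancel]⟩)), ?_⟩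
      obtain ⟨h1, h2⟩ := hch i
      obtain ⟨h3, h4⟩ := hch (i - 1)
      have h5 := (hd0 (c (i - 1))).2 ⟨_, rfl⟩
      rw [h0, h5, dif_pos h1, dif_pos h3, h2, h4]
      omega
    · refine ⟨p u, Or.inl ⟨h0, rfl⟩, ?_⟩
      have h1 := (hpar u h0).1
      have h2 : ¬∃ i, u = c i := fun h => h0 ((hd0 u).2 h)
      rw [dif_neg h2, ← h1, add_mul, one_mul]
      split_ifs with h3
      · have := h3.choose.val_lt
        omega
      · omega
  have hcyc : G'.HasCycle := ⟨g, hg, c, hinj, fun i => Or.inr (Or.inr (Or.inl ⟨i, rfl, rfl⟩))⟩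
  refine ⟨g, c, p, dep, hg, hinj, hd0, hpd, fun u hu => (hpar u hu).1, fun u w =>
    ⟨fun hadj => ?_, hRG u w⟩⟩
  by_contra hR
  have hd : ∀ u w, G.dist u w ≤ G'.dist u w := fun u w =>
    Reachable.dist_anti hle (hconn.preconnected u w)
  refine h.false_of_nonneg_of_pos (h.sum_nonpos hconn hcyc (fun u w => G'.dist u w - G.dist u w)
    fun u w => by omega) (fun u w => by have := hd u w; omega) (a := u) (b := w) ?_
  have h1 := dist_eq_one_iff_adj.2 hadj
  have h2 := hconn.one_lt_dist_of_ne_of_not_adj hadj.ne (show ¬G'.Adj u w from hR)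
  omega

end SimpleGraph

namespace SimpleGraph

variable {V : Type*}

/-! ### Rerouting edges at a branching vertex -/

/-- The edges joining the complement of `S` to `v ∈ S` are redirected to `b ∈ S`. -/
def reroute (G : SimpleGraph V) (S : Set V) (v b : V) : SimpleGraph V :=
  fromRel fun u w => (G.Adj u w ∧ (u ∈ S ↔ w ∈ S)) ∨ (u ∉ S ∧ w = b ∧ G.Adj u v)

/-- `S` is attached to the rest of `G` at `v` only, and `B ⊆ S` is a branch at `v` whose only edge
to the rest of `S` is `vb`. -/
structure IsBranch (G : SimpleGraph V) (S B : Set V) (v b : V) : Prop where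
  subset : B ⊆ S
  mem : v ∈ S
  notMem : v ∉ B
  mem_branch : b ∈ B
  adj : G.Adj v b
  cross : ∀ u w, G.Adj u w → u ∉ S → w ∈ S → w = v
  bridge : ∀ u w, G.Adj u w → u ∈ B → w ∈ S → w ∉ B → u = b ∧ w = v

namespace IsBranch

variable {G : SimpleGraph V} {S B : Set V} {v b : V}

theorem reroute_adj (h : G.IsBranch S B v b) (u w : V) : (G.reroute S v b).Adj u w ↔
    (G.Adj u w ∧ (u ∈ S ↔ w ∈ S)) ∨ (u ∉ S ∧ w = b ∧ G.Adj u v) ∨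
      (w ∉ S ∧ u = b ∧ G.Adj w v) := by
  have hb := h.subset h.mem_branch
  rw [reroute, fromRel_adj]
  constructor
  · rintro ⟨-, (h1 | h1) | (h1 | h1)⟩
    exacts [Or.inl h1, Or.inr (Or.inl h1), Or.inl ⟨h1.1.symm, h1.2.symm⟩, Or.inr (Or.inr h1)]
  · rintro (h1 | h1 | h1)
    · exact ⟨h1.1.ne, Or.inl (Or.inl h1)⟩
    · exact ⟨fun h2 => h1.1 (h2 ▸ h1.2.1 ▸ hb), Or.inl (Or.inr h1)⟩
    · exact ⟨fun h2 => h1.1 (h2 ▸ h1.2.1 ▸ hb), Or.inr (Or.inr h1)⟩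

theorem reroute_connected (h : G.IsBranch S B v b) (hG : G.Connected) :
    (G.reroute S v b).Connected := by
  have hb := h.subset h.mem_branch
  have hvb : (G.reroute S v b).Adj v b := (h.reroute_adj _ _).2 (Or.inl ⟨h.adj, by simp [hb, h.mem]⟩)
  refine hG.of_forall_adj_reachable fun a a' hadj => ?_
  by_cases ha : a ∈ S <;> by_cases ha' : a' ∈ S
  · exact ((h.reroute_adj _ _).2 (Or.inl ⟨hadj, by simp [ha, ha']⟩)).reachable
  · obtain rfl := h.cross _ _ hadj.symm ha' ha
    exact hvb.reachable.trans
      ((h.reroute_adj _ _).2 (Or.inr (Or.inr ⟨ha', rfl, hadj.symm⟩))).reachable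
  · obtain rfl := h.cross _ _ hadj ha ha'
    exact (((h.reroute_adj _ _).2 (Or.inr (Or.inl ⟨ha, rfl, hadj⟩))).reachable).trans
      hvb.symm.reachable
  · exact ((h.reroute_adj _ _).2 (Or.inl ⟨hadj, by simp [ha, ha']⟩)).reachable

open Classical in
/-- Lower bounds for the distances after rerouting: pairs separated by `S` come closer by one if
they meet `B`, and move apart by one otherwise. -/
theorem le_reroute_dist (h : G.IsBranch S B v b) (hG : G.Connected) (u w : V) :
    (if (u ∈ S ↔ w ∈ S) then 0 else if u ∈ B ∨ w ∈ B then -1 else 1 : ℤ) + G.dist u w ≤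
      (G.reroute S v b).dist u w := by
  have hG' := h.reroute_connected hG
  have hb := h.subset h.mem_branch
  have hvb := dist_eq_one_iff_adj.2 h.adj
  -- distances seen from outside `S`
  have key : ∀ u, u ∉ S → ∀ w, (if w ∈ S then
      (if w ∈ B then G.dist u v + G.dist b w else G.dist u v + 1 + G.dist v w)
      else G.dist u w) ≤ (G.reroute S v b).dist u w := by
    intro u hu w
    have h1 := le_add_dist_of_lipschitz hG' (fun w => if w ∈ S then
      (if w ∈ B then G.dist u v + G.dist b w else G.dist u v + 1 + G.dist v w)
      else G.dist u w) (fun a a' hadj => ?_) u w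
    · simpa only [if_neg hu, dist_self, zero_add] using h1
    · rcases (h.reroute_adj _ _).1 hadj with ⟨h2, h3⟩ | ⟨h2, rfl, h3⟩ | ⟨h2, rfl, h3⟩
      · have e1 := hG.dist_le_succ_of_adj u h2
        have e2 := hG.dist_le_succ_of_adj b h2
        have e3 := hG.dist_le_succ_of_adj v h2
        by_cases ha : a ∈ S
        · have ha' := h3.1 ha
          simp only [if_pos ha, if_pos ha']
          by_cases hB : a ∈ B <;> by_cases hB' : a' ∈ B
          · simp only [if_pos hB, if_pos hB']; omega
          · obtain ⟨rfl, rfl⟩ := h.bridge _ _ h2 hB ha' hB'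
            simp [hB, hB']
          · obtain ⟨rfl, rfl⟩ := h.bridge _ _ h2.symm hB' ha hB
            simp only [if_neg hB, if_pos hB', dist_self]; omega
          · simp only [if_neg hB, if_neg hB']; omega
        · have ha' : a' ∉ S := fun h => ha (h3.2 h)
          simp only [if_neg ha, if_neg ha']; omega
      · have e1 := hG.dist_le_succ_of_adj u h3
        simp only [if_neg h2, if_pos hb, if_pos h.mem_branch, dist_self]; omega
      · have e1 := hG.dist_le_succ_of_adj u h3.symm
        simp only [if_neg h2, if_pos hb, if_pos h.mem_branch, dist_self]; omega
  have key' : ∀ u, u ∉ S → ∀ w, w ∈ S → (if w ∈ B then -1 else 1 : ℤ) + G.dist u w ≤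
      (G.reroute S v b).dist u w := by
    intro u hu w hw
    have h1 := key u hu w
    rw [if_pos hw] at h1
    have h2 := hG.dist_triangle (u := u) (v := v) (w := w)
    have h3 := hG.dist_triangle (u := v) (v := b) (w := w)
    split_ifs at h1 ⊢ <;> omega
  by_cases hu : u ∈ S <;> by_cases hw : w ∈ S
  · rw [if_pos (by simp [hu, hw]), zero_add]
    -- the truncated `G.dist v w - 1` is harmless, as `w ≠ v` outside `S`
    have h1 := le_add_dist_of_lipschitz hG'
      (fun w => if w ∈ S then G.dist u w else G.dist v w - 1 + G.dist u b) (fun a a' hadj => ?_) u w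
    · simp only [if_pos hu, if_pos hw, dist_self, zero_add] at h1
      exact_mod_cast h1
    · rcases (h.reroute_adj _ _).1 hadj with ⟨h2, h3⟩ | ⟨h2, rfl, h3⟩ | ⟨h2, rfl, h3⟩
      · have e1 := hG.dist_le_succ_of_adj u h2
        have e3 := hG.dist_le_succ_of_adj v h2
        by_cases ha : a ∈ S
        · simp only [if_pos ha, if_pos (h3.1 ha)]; omega
        · simp only [if_neg ha, if_neg (fun h => ha (h3.2 h))]; omega
      · have e1 := dist_eq_one_iff_adj.2 h3.symm
        simp only [if_neg h2, if_pos hb]; omega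
      · have e1 := dist_eq_one_iff_adj.2 h3.symm
        simp only [if_neg h2, if_pos hb]; omega
  · have h1 := key' w hw u hu
    rw [dist_comm, dist_comm (u := w)] at h1
    simpa [hu, hw, show w ∉ B from fun h' => hw (h.subset h')] using h1
  · have h1 := key' u hu w hw
    simpa [hu, hw, show u ∉ B from fun h' => hu (h.subset h')] using h1
  · rw [if_pos (by simp [hu, hw]), zero_add]
    have h1 := key u hu w
    rw [if_neg hw] at h1
    exact_mod_cast h1

end IsBranch

variable [Fintype V]

/-- An energy-maximal graph has no vertex `v` with two branches `B₁`, `B₂` inside a part `S` that is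
attached to the rest at `v`: reattach the rest of the graph at the root of `B₁` or of `B₂`; the
gains and losses on `B₁` and `B₂` cancel and the gain at `v` remains. -/
theorem IsEnergyMax.false_of_branches {G : SimpleGraph V} {x : V → ℝ} (h : G.IsEnergyMax x)
    {S B₁ B₂ : Set V} {v b₁ b₂ : V} (h₁ : G.IsBranch S B₁ v b₁) (h₂ : G.IsBranch S B₂ v b₂)
    (hdisj : ∀ u ∈ B₁, u ∉ B₂) (hS : ∃ u, u ∉ S) (hc₁ : (G.reroute S v b₁).HasCycle)
    (hc₂ : (G.reroute S v b₂).HasCycle) : False := by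
  classical
  obtain ⟨u, hu⟩ := hS
  have s₁ := h.sum_nonpos (h₁.reroute_connected h.connected) hc₁ _
    (h₁.le_reroute_dist h.connected)
  have s₂ := h.sum_nonpos (h₂.reroute_connected h.connected) hc₂ _
    (h₂.le_reroute_dist h.connected)
  have s := add_nonpos s₁ s₂
  simp only [← Finset.sum_add_distrib, ← add_mul, ← Int.cast_add] at s
  refine h.false_of_nonneg_of_pos s (fun a a' => ?_) (a := u) (b := v) ?_
  · have e1 := hdisj a
    have e2 := hdisj a'
    have f1 := @h₁.subset a
    have f2 := @h₁.subset a'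
    have f3 := @h₂.subset a
    have f4 := @h₂.subset a'
    split_ifs <;> first | omega | (exfalso; tauto)
  · have f1 : u ∉ B₁ := fun h => hu (h₁.subset h)
    have f2 : u ∉ B₂ := fun h => hu (h₂.subset h)
    simp [hu, h₁.mem, h₁.notMem, h₂.notMem, f1, f2]

end SimpleGraph

namespace SimpleGraph

variable {V : Type*}

namespace CycleForest

variable {G : SimpleGraph V} {g : ℕ} {c : ZMod g → V} {p : V → V} {dep : V → ℕ}

/-- The descendants of `b`, including `b` itself. -/
def descendants (p : V → V) (b : V) : Set V := {u | ∃ k, p^[k] u = b}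

theorem self_mem_descendants (p : V → V) (b : V) : b ∈ descendants p b := ⟨0, rfl⟩

theorem mem_descendants_of_parent {b u : V} (h : p u ∈ descendants p b) : u ∈ descendants p b := by
  obtain ⟨k, hk⟩ := h
  exact ⟨k + 1, by rwa [Function.iterate_succ_apply]⟩

theorem parent_mem_descendants {b u : V} (h : u ∈ descendants p b) (hne : u ≠ b) :
    p u ∈ descendants p b := by
  obtain ⟨k, hk⟩ := h
  cases k with
  | zero => exact absurd hk hne
  | succ k => exact ⟨k, by rwa [Function.iterate_succ_apply] at hk⟩

theorem dep_cycle (F : CycleForest G g c p dep) (i : ZMod g) : dep (c i) = 0 :=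
  (F.dep_eq_zero _).2 ⟨i, rfl⟩

theorem dep_parent_le (F : CycleForest G g c p dep) (u : V) : dep (p u) ≤ dep u := by
  by_cases h : dep u = 0
  · rw [F.parent_of_dep u h]
  · have := F.dep_parent u h
    omega

theorem dep_le_of_mem (F : CycleForest G g c p dep) {b u : V} (h : u ∈ descendants p b) :
    dep b ≤ dep u := by
  obtain ⟨k, rfl⟩ := h
  induction k generalizing u with
  | zero => rfl
  | succ k ih => exact (ih (u := p u)).trans (F.dep_parent_le u)

theorem cycle_eq_of_mem (F : CycleForest G g c p dep) {b : V} {i : ZMod g}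
    (h : c i ∈ descendants p b) : c i = b := by
  obtain ⟨k, hk⟩ := h
  rwa [Function.iterate_fixed (F.parent_of_dep _ (F.dep_cycle i))] at hk

theorem eq_of_adj_of_mem (F : CycleForest G g c p dep) {b u w : V} (hadj : G.Adj u w)
    (hu : u ∉ descendants p b) (hw : w ∈ descendants p b) : w = b ∧ (dep b ≠ 0 → u = p b) := by
  rcases (F.adj u w).1 hadj with ⟨-, rfl⟩ | ⟨h1, rfl⟩ | ⟨i, rfl, rfl⟩ | ⟨i, rfl, rfl⟩
  · exact absurd (mem_descendants_of_parent hw) hu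
  · have : w = b := by
      by_contra hne
      exact hu (parent_mem_descendants hw hne)
    exact ⟨this, fun _ => this ▸ rfl⟩
  · have := F.cycle_eq_of_mem hw
    exact ⟨this, fun h => absurd (this ▸ F.dep_cycle _) h⟩
  · have := F.cycle_eq_of_mem hw
    exact ⟨this, fun h => absurd (this ▸ F.dep_cycle _) h⟩

theorem parent_notMem (F : CycleForest G g c p dep) {b : V} (hb : dep b ≠ 0) :
    p b ∉ descendants p b := fun h => by
  have h1 := F.dep_le_of_mem h
  have h2 := F.dep_parent b hb
  omega

theorem isBranch (F : CycleForest G g c p dep) {b : V} (hb : dep b ≠ 0) :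
    G.IsBranch (descendants p (p b)) (descendants p b) (p b) b where
  subset := by
    rintro u ⟨k, rfl⟩
    exact ⟨k + 1, Function.iterate_succ_apply' _ _ _⟩
  mem := self_mem_descendants _ _
  notMem := F.parent_notMem hb
  mem_branch := self_mem_descendants _ _
  adj := (F.adj _ _).2 (Or.inr (Or.inl ⟨hb, rfl⟩))
  cross u w hadj hu hw := (F.eq_of_adj_of_mem hadj hu hw).1
  bridge u w hadj hu _ hw := by
    have := F.eq_of_adj_of_mem hadj.symm hw hu
    exact ⟨this.1, this.2 hb⟩

theorem disjoint_descendants (F : CycleForest G g c p dep) {b₁ b₂ : V} (h₁ : dep b₁ ≠ 0)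
    (h₂ : dep b₂ ≠ 0) (hp : p b₁ = p b₂) (hne : b₁ ≠ b₂) :
    ∀ u ∈ descendants p b₁, u ∉ descendants p b₂ := by
  rintro u ⟨k, hk⟩ ⟨l, hl⟩
  rcases le_total k l with hkl | hkl
  · have h3 : b₁ ∈ descendants p b₂ :=
      ⟨l - k, by rw [← hk, ← Function.iterate_add_apply, Nat.sub_add_cancel hkl, hl]⟩
    exact F.parent_notMem h₂ (hp ▸ parent_mem_descendants h3 hne)
  · have h3 : b₂ ∈ descendants p b₁ :=
      ⟨k - l, by rw [← hl, ← Function.iterate_add_apply, Nat.sub_add_cancel hkl, hk]⟩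
    exact F.parent_notMem h₁ (hp ▸ parent_mem_descendants h3 hne.symm)

theorem cycle_adj (F : CycleForest G g c p dep) (i : ZMod g) : G.Adj (c i) (c (i + 1)) :=
  (F.adj _ _).2 (Or.inr (Or.inr (Or.inl ⟨i, rfl, rfl⟩)))

theorem reroute_hasCycle (F : CycleForest G g c p dep) {b : V} (hb : dep b ≠ 0) :
    (G.reroute (descendants p (p b)) (p b) b).HasCycle := by
  have hB := F.isBranch hb
  have hS : ∀ i, c i ∈ descendants p (p b) → c i = p b := fun i => F.cycle_eq_of_mem
  by_cases hv : ∃ i, c i = p b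
  · -- the root of the branch takes the place of its parent on the cycle
    obtain ⟨i, hi⟩ := hv
    have hout : ∀ j, j ≠ i → c j ∉ descendants p (p b) := fun j hj h =>
      hj (F.inj ((hS j h).trans hi.symm))
    have hbc : ∀ j, b ≠ c j := fun j h => hb (h ▸ F.dep_cycle j)
    have : Fact (1 < g) := ⟨by have := F.three_le; omega⟩
    refine ⟨g, F.three_le, Function.update c i b, fun j k hjk => ?_, fun j => ?_⟩
    · by_cases hj : j = i <;> by_cases hk : k = i
      · rw [hj, hk]
      · subst hj
        rw [Function.update_self, Function.update_of_ne hk] at hjk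
        exact absurd hjk (hbc k)
      · subst hk
        rw [Function.update_self, Function.update_of_ne hj] at hjk
        exact absurd hjk.symm (hbc j)
      · rw [Function.update_of_ne hj, Function.update_of_ne hk] at hjk
        exact F.inj hjk
    · rw [hB.reroute_adj]
      by_cases hj : j = i
      · subst hj
        have hj1 : j + 1 ≠ j := by simp
        rw [Function.update_self, Function.update_of_ne hj1]
        exact Or.inr (Or.inr ⟨hout _ hj1, rfl, hi ▸ (F.cycle_adj j).symm⟩)
      · by_cases hj1 : j + 1 = i
        · subst hj1
          rw [Function.update_self, Function.update_of_ne hj]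
          exact Or.inr (Or.inl ⟨hout _ hj, rfl, hi ▸ F.cycle_adj j⟩)
        · rw [Function.update_of_ne hj, Function.update_of_ne hj1]
          exact Or.inl ⟨F.cycle_adj j, by simp [hout _ hj, hout _ hj1]⟩
  · have hout : ∀ j, c j ∉ descendants p (p b) := fun j h => hv ⟨j, hS j h⟩
    exact ⟨g, F.three_le, c, F.inj, fun j => (hB.reroute_adj _ _).2
      (Or.inl ⟨F.cycle_adj j, by simp [hout]⟩)⟩

/-- In an energy-maximal graph every vertex has at most one child, so the trees are paths. -/
theorem parent_injective [Fintype V] {x : V → ℝ} (F : CycleForest G g c p dep)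
    (h : G.IsEnergyMax x) {b₁ b₂ : V} (h₁ : dep b₁ ≠ 0) (h₂ : dep b₂ ≠ 0) (hp : p b₁ = p b₂) :
    b₁ = b₂ := by
  by_contra hne
  have : Fact (1 < g) := ⟨by have := F.three_le; omega⟩
  refine h.false_of_branches (F.isBranch h₁) (hp ▸ F.isBranch h₂)
    (F.disjoint_descendants h₁ h₂ hp hne) ?_ (F.reroute_hasCycle h₁) (hp ▸ F.reroute_hasCycle h₂)
  by_contra! hall
  have h3 := (F.cycle_eq_of_mem (hall (c 0))).trans (F.cycle_eq_of_mem (hall (c 1))).symm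
  exact zero_ne_one (F.inj h3)

end CycleForest

/-! ### Cycles with pendant paths -/

/-- `G` is a cycle of length `g` with a (possibly trivial) path attached at each of its vertices:
the vertex `u` lies on the path attached at the cycle vertex number `ι u`, at distance `dep u`
from the cycle. -/
structure CycleTails (G : SimpleGraph V) (g : ℕ) (ι : V → ZMod g) (dep : V → ℕ) : Prop where
  three_le : 3 ≤ g
  inj : ∀ u w, ι u = ι w → dep u = dep w → u = w
  root : ∀ i, ∃ u, ι u = i ∧ dep u = 0
  down : ∀ u k, dep u = k + 1 → ∃ w, ι w = ι u ∧ dep w = k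
  adj : ∀ u w, G.Adj u w ↔ (ι u = ι w ∧ (dep u = dep w + 1 ∨ dep w = dep u + 1)) ∨
    (dep u = 0 ∧ dep w = 0 ∧ (ι w = ι u + 1 ∨ ι u = ι w + 1))

theorem IsEnergyMax.exists_cycleTails [Fintype V] {G : SimpleGraph V} {x : V → ℝ}
    (h : G.IsEnergyMax x) : ∃ g ι dep, CycleTails G g ι dep := by
  obtain ⟨g, c, p, dep, F⟩ := h.exists_cycleForest
  have hroot : ∀ u, dep (p^[dep u] u) = 0 := by
    intro u
    induction hn : dep u generalizing u with
    | zero => simpa using hn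
    | succ n ih =>
      have := F.dep_parent u (by omega)
      rw [Function.iterate_succ_apply]
      exact ih (p u) (by omega)
  choose ι hι using fun u => (F.dep_eq_zero _).1 (hroot u)
  have hιp : ∀ u, dep u ≠ 0 → ι (p u) = ι u := by
    intro u hu
    apply F.inj
    have := F.dep_parent u hu
    rw [← hι, ← hι, ← this, Function.iterate_succ_apply]
  have hιc : ∀ u, dep u = 0 → u = c (ι u) := by
    intro u hu
    rw [← hι, hu]
    rfl
  have hcι : ∀ i, ι (c i) = i := fun i => (F.inj (hιc (c i) (F.dep_cycle i))).symm
  have hinj : ∀ n u w, dep u = n → dep w = n → ι u = ι w → u = w := by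
    intro n
    induction n with
    | zero => intro u w hu hw huw; rw [hιc u hu, hιc w hw, huw]
    | succ n ih =>
      intro u w hu hw huw
      have h1 := F.dep_parent u (by omega)
      have h2 := F.dep_parent w (by omega)
      refine F.parent_injective h (by omega) (by omega)
        (ih _ _ (by omega) (by omega) ?_)
      rw [hιp u (by omega), hιp w (by omega), huw]
  have hpar : ∀ u w, ι u = ι w → dep u = dep w + 1 → w = p u := by
    intro u w h1 h2
    have h3 := F.dep_parent u (by omega)
    exact hinj (dep w) _ _ rfl (by omega) (by rw [hιp u (by omega), h1])
  refine ⟨g, ι, dep, F.three_le, fun u w h1 h2 => hinj (dep w) u w h2 rfl h1,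
    fun i => ⟨c i, hcι i, F.dep_cycle i⟩, fun u k hk => ⟨p u, hιp u (by omega), ?_⟩,
    fun u w => ?_⟩
  · have := F.dep_parent u (by omega)
    omega
  · rw [F.adj]
    constructor
    · rintro (⟨h1, rfl⟩ | ⟨h1, rfl⟩ | ⟨i, rfl, rfl⟩ | ⟨i, rfl, rfl⟩)
      · exact Or.inl ⟨(hιp u h1).symm, Or.inl (F.dep_parent u h1).symm⟩
      · exact Or.inl ⟨hιp w h1, Or.inr (F.dep_parent w h1).symm⟩
      · exact Or.inr ⟨F.dep_cycle _, F.dep_cycle _, Or.inl (by rw [hcι, hcι])⟩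
      · exact Or.inr ⟨F.dep_cycle _, F.dep_cycle _, Or.inr (by rw [hcι, hcι])⟩
    · rintro (⟨h1, h2 | h2⟩ | ⟨h1, h2, h3 | h3⟩)
      · exact Or.inl ⟨by omega, hpar u w h1 h2⟩
      · exact Or.inr (Or.inl ⟨by omega, hpar w u h1.symm h2⟩)
      · exact Or.inr (Or.inr (Or.inl ⟨ι u, hιc u h1, h3 ▸ hιc w h2⟩))
      · exact Or.inr (Or.inr (Or.inr ⟨ι w, hιc w h2, h3 ▸ hιc u h1⟩))

end SimpleGraph

namespace SimpleGraph

/-! ### Redirecting edges of the cycle -/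

variable {V : Type*}

/-- The distance between the vertices with coordinates `(i, s)` and `(j, t)` in a cycle of length
`g` with pendant paths; `i, j < g`. -/
def cycDist (g i s j t : ℕ) : ℕ :=
  if i = j then (s - t) + (t - s)
  else s + t + min ((i - j) + (j - i)) (g - ((i - j) + (j - i)))

/-- The distance after the edge between the cycle vertices `0` and `g - 1` is replaced by the chord
between `0` and `2`. -/
def cutDist (i s j t : ℕ) : ℕ :=
  if i = j then (s - t) + (t - s)
  else s + t + ((i - j) + (j - i)) - (if (i = 0 ∧ 2 ≤ j) ∨ (j = 0 ∧ 2 ≤ i) then 1 else 0)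

/-- The distance after the edge between the cycle vertices `0` and `g - 1` is replaced by an edge
between `0` and the neighbour of the cycle on the path attached at `1`. -/
def pendDist (i s j t : ℕ) : ℕ :=
  if i = j then (s - t) + (t - s)
  else s + t + ((i - j) + (j - i)) -
    (if (i = 0 ∧ j = 1 ∧ 1 ≤ t) ∨ (j = 0 ∧ i = 1 ∧ 1 ≤ s) then 1 else 0)

/-- The distance, starting from a cycle of length four, after the vertex `0` has been detached from
the cycle and joined to the vertices at distances one and two from the cycle on the path attached
at `1`. -/
def deepDist (i s j t : ℕ) : ℕ :=
  if i = j then (s - t) + (t - s)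
  else if i = 0 then
    (if j = 1 then s + (if t = 0 then 2 else if t = 1 then 1 else t - 1) else s + t + j + 1)
  else if j = 0 then
    (if i = 1 then t + (if s = 0 then 2 else if s = 1 then 1 else s - 1) else s + t + i + 1)
  else s + t + ((i - j) + (j - i))

namespace CycleTails

variable {G : SimpleGraph V} {g : ℕ} {ι : V → ZMod g} {dep : V → ℕ}

theorem neZero (T : CycleTails G g ι dep) : NeZero g := ⟨by have := T.three_le; omega⟩

theorem rotate (T : CycleTails G g ι dep) (s : ZMod g) :
    CycleTails G g (fun u => ι u + s) dep where
  three_le := T.three_le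
  inj u w h := T.inj u w (add_right_cancel h)
  root i := by
    obtain ⟨u, hu, h0⟩ := T.root (i - s)
    exact ⟨u, by rw [hu, sub_add_cancel], h0⟩
  down u k hk := by
    obtain ⟨w, hw, h⟩ := T.down u k hk
    exact ⟨w, by rw [hw], h⟩
  adj u w := by
    rw [T.adj, add_left_inj, add_right_comm, add_left_inj, add_right_comm, add_left_inj]

theorem reflect (T : CycleTails G g ι dep) : CycleTails G g (fun u => -ι u) dep where
  three_le := T.three_le
  inj u w h := T.inj u w (neg_injective h)
  root i := by
    obtain ⟨u, hu, h0⟩ := T.root (-i)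
    exact ⟨u, by rw [hu, neg_neg], h0⟩
  down u k hk := by
    obtain ⟨w, hw, h⟩ := T.down u k hk
    exact ⟨w, by rw [hw], h⟩
  adj u w := by
    have h1 : ∀ a b : ZMod g, -a = -b + 1 ↔ b = a + 1 := fun a b =>
      ⟨fun h => by linear_combination h, fun h => by linear_combination h⟩
    rw [T.adj, neg_inj, h1, h1]
    tauto

theorem val_lt (T : CycleTails G g ι dep) (u : V) : (ι u).val < g :=
  have := T.neZero
  (ι u).val_lt

theorem val_inj (T : CycleTails G g ι dep) (u w : V) : (ι u).val = (ι w).val ↔ ι u = ι w :=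
  have := T.neZero
  (ZMod.val_injective g).eq_iff

theorem eq_of_trivial (T : CycleTails G g ι dep) {i : ZMod g} {y : V}
    (hP : ∀ u, ι u = i → dep u = 0) (hy : ι y = i) (u : V) : ι u = i ↔ u = y :=
  ⟨fun hu => T.inj _ _ (hu.trans hy.symm) ((hP u hu).trans (hP y hy).symm), fun hu => hu ▸ hy⟩

theorem root_val (T : CycleTails G g ι dep) {k : ℕ} (hk : k < g) :
    ∃ u, (ι u).val = k ∧ dep u = 0 := by
  obtain ⟨u, hu, h0⟩ := T.root (k : ZMod g)
  exact ⟨u, by rw [hu, ZMod.val_natCast_of_lt hk], h0⟩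

theorem down_le (T : CycleTails G g ι dep) (u : V) {k : ℕ} (hk : k ≤ dep u) :
    ∃ w, ι w = ι u ∧ dep w = k := by
  obtain ⟨d, hd⟩ := Nat.exists_eq_add_of_le hk
  induction d generalizing k with
  | zero => exact ⟨u, rfl, hd⟩
  | succ d ih =>
    obtain ⟨w, hw, hw'⟩ := ih (k := k + 1) (by omega) (by omega)
    obtain ⟨w', h1, h2⟩ := T.down w k hw'
    exact ⟨w', h1.trans hw, h2⟩

theorem dist_le_of_dep_eq (T : CycleTails G g ι dep) (hG : G.Connected) {u w : V} {k : ℕ}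
    (h : ι u = ι w) (hk : dep u = dep w + k) : G.dist u w ≤ k := by
  induction k generalizing u with
  | zero => rw [T.inj u w h hk, dist_self]
  | succ k ih =>
    obtain ⟨u', h1, h2⟩ := T.down u (dep w + k) (by omega)
    have h3 := ih (h1.trans h) h2
    have h4 := hG.dist_le_succ_of_adj w (a := u') (b := u)
      ((T.adj _ _).2 (Or.inl ⟨h1, Or.inr (by omega)⟩))
    rw [dist_comm, dist_comm (u := w)] at h4
    omega

theorem dist_root_le (T : CycleTails G g ι dep) (hG : G.Connected) {u w : V} {k : ℕ}
    (hu : dep u = 0) (hw : dep w = 0) (h : ι w = ι u + k) : G.dist u w ≤ k := by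
  induction k generalizing w with
  | zero => rw [T.inj u w (by simpa using h.symm) (by omega), dist_self]
  | succ k ih =>
    obtain ⟨w', h1, h2⟩ := T.root (ι u + k)
    have h3 := ih h2 h1
    have h4 := hG.dist_le_succ_of_adj u (a := w') (b := w)
      ((T.adj _ _).2 (Or.inr ⟨h2, hw, Or.inl (by rw [h, h1]; push_cast; ring)⟩))
    omega

theorem dist_le_of_add (T : CycleTails G g ι dep) (hG : G.Connected) {u w : V} {k : ℕ}
    (h : ι w = ι u + k) : G.dist u w ≤ dep u + dep w + k := by
  obtain ⟨u', h1, h2⟩ := T.root (ι u)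
  obtain ⟨w', h3, h4⟩ := T.root (ι w)
  have e1 := T.dist_le_of_dep_eq hG h1.symm (show dep u = dep u' + dep u by omega)
  have e2 := T.dist_le_of_dep_eq hG h3.symm (show dep w = dep w' + dep w by omega)
  have e3 := T.dist_root_le hG h2 h4 (by rw [h1, h3, h])
  have e4 := hG.dist_triangle (u := u) (v := u') (w := w)
  have e5 := hG.dist_triangle (u := u') (v := w') (w := w)
  rw [dist_comm] at e2
  omega

theorem dist_le_cycDist (T : CycleTails G g ι dep) (hG : G.Connected) (u w : V) :
    G.dist u w ≤ cycDist g (ι u).val (dep u) (ι w).val (dep w) := by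
  have := T.neZero
  have key : ∀ u w, (ι u).val ≤ (ι w).val → ι u ≠ ι w → G.dist u w ≤ dep u + dep w +
      min ((ι w).val - (ι u).val) (g - ((ι w).val - (ι u).val)) := by
    intro u w hle _
    have h1 := T.dist_le_of_add hG (u := u) (w := w) (k := (ι w).val - (ι u).val)
      (by rw [Nat.cast_sub hle]; simp)
    have h2 := T.dist_le_of_add hG (u := w) (w := u) (k := g - ((ι w).val - (ι u).val))
      (by rw [Nat.cast_sub (by have := T.val_lt w; omega), Nat.cast_sub hle]; simp)
    rw [dist_comm] at h2
    omega
  unfold cycDist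
  split_ifs with h
  · rw [T.val_inj] at h
    rcases le_total (dep u) (dep w) with h1 | h1
    · have := T.dist_le_of_dep_eq hG h.symm (Nat.add_sub_cancel' h1).symm
      rw [dist_comm]
      omega
    · have := T.dist_le_of_dep_eq hG h (Nat.add_sub_cancel' h1).symm
      omega
  · rcases le_total (ι u).val (ι w).val with h1 | h1
    · have := key u w h1 (fun e => h (by rw [e]))
      omega
    · have := key w u h1 (fun e => h (by rw [e]))
      rw [dist_comm] at this
      omega

/-- The graph with the same pendant paths as `G`, the edges of the cycle being replaced by `R`. -/
def tailGraph (ι : V → ZMod g) (dep : V → ℕ) (R : V → V → Prop) : SimpleGraph V :=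
  fromRel fun u w => (ι u = ι w ∧ dep w = dep u + 1) ∨ R u w

/-- The energy inequality for replacing the cycle edges by `R`, where `D`, a function of the
coordinates of two vertices, is a lower bound for the new distances because it changes by at most one
along each new edge. -/
theorem sum_nonpos_of_move [Fintype V] {x : V → ℝ} (T : CycleTails G g ι dep)
    (h : G.IsEnergyMax x) (R : V → V → Prop) (D : ℕ → ℕ → ℕ → ℕ → ℕ)
    (hconn : (tailGraph ι dep R).Connected) (hcyc : (tailGraph ι dep R).HasCycle)
    (hD0 : ∀ i s, D i s i s = 0)
    (hDt : ∀ i s j t, D i s j (t + 1) ≤ D i s j t + 1 ∧ D i s j t ≤ D i s j (t + 1) + 1)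
    (hDR : ∀ i s a b, i < g → R a b →
      D i s (ι b).val (dep b) ≤ D i s (ι a).val (dep a) + 1 ∧
      D i s (ι a).val (dep a) ≤ D i s (ι b).val (dep b) + 1) :
    ∑ u, ∑ w, (((D (ι u).val (dep u) (ι w).val (dep w) : ℤ) -
      cycDist g (ι u).val (dep u) (ι w).val (dep w) : ℤ) : ℝ) * (x u + x w) ^ 2 ≤ 0 := by
  refine h.sum_nonpos hconn hcyc _ fun u w => ?_
  have h1 := T.dist_le_cycDist h.connected u w
  have h2 := le_add_dist_of_lipschitz hconn (fun w => D (ι u).val (dep u) (ι w).val (dep w))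
    (fun a b hab => ?_) u w
  · simp only [hD0, zero_add] at h2
    omega
  · rcases ((fromRel_adj _ _ _).1 hab).2 with (⟨e1, e2⟩ | e) | (⟨e1, e2⟩ | e)
    · simp only [e1, e2]; exact (hDt _ _ _ _).1
    · exact (hDR _ _ _ _ (T.val_lt u) e).1
    · simp only [e1, e2]; exact (hDt _ _ _ _).2
    · exact (hDR _ _ _ _ (T.val_lt u) e).2

theorem tailGraph_adj_parent {R : V → V → Prop} {u w : V} (h1 : ι w = ι u)
    (h2 : dep u = dep w + 1) : (tailGraph ι dep R).Adj u w :=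
  (fromRel_adj _ _ _).2 ⟨fun h => by subst h; omega, Or.inr (Or.inl ⟨h1, h2⟩)⟩

theorem tailGraph_adj_of {R : V → V → Prop} {u w : V} (hne : u ≠ w) (h : R u w ∨ R w u) :
    (tailGraph ι dep R).Adj u w :=
  (fromRel_adj _ _ _).2 ⟨hne, h.imp Or.inr Or.inr⟩

theorem tailGraph_connected (T : CycleTails G g ι dep) {R : V → V → Prop}
    (hR : ∀ u w, dep u = 0 → dep w = 0 → (ι u).val + 1 = (ι w).val → R u w) :
    (tailGraph ι dep R).Connected := by
  obtain ⟨b, hb1, hb2⟩ := T.root_val (k := 0) (by have := T.three_le; omega)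
  refine connected_of_rank b (fun u => dep u + (ι u).val) fun u hu => ?_
  by_cases h0 : dep u = 0
  · have h1 : (ι u).val ≠ 0 := fun h => hu (T.inj _ _ ((T.val_inj _ _).1 (h.trans hb1.symm))
      (h0.trans hb2.symm))
    obtain ⟨w, hw1, hw2⟩ := T.root_val (k := (ι u).val - 1) (by have := T.val_lt u; omega)
    exact ⟨w, tailGraph_adj_of (fun h => by subst h; omega)
      (Or.inr (hR _ _ hw2 h0 (by omega))), by omega⟩
  · obtain ⟨w, hw1, hw2⟩ := T.down u (dep u - 1) (by omega)
    exact ⟨w, tailGraph_adj_parent hw1 (by omega), by rw [hw1]; omega⟩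

variable [Fintype V] {x : V → ℝ}

theorem sum_cut_nonpos (T : CycleTails G g ι dep) (h : G.IsEnergyMax x) :
    ∑ u, ∑ w, (((cutDist (ι u).val (dep u) (ι w).val (dep w) : ℤ) -
      cycDist g (ι u).val (dep u) (ι w).val (dep w) : ℤ) : ℝ) * (x u + x w) ^ 2 ≤ 0 := by
  have h3 := T.three_le
  refine T.sum_nonpos_of_move h (fun a b => dep a = 0 ∧ dep b = 0 ∧
    ((ι a).val + 1 = (ι b).val ∨ ((ι a).val = 0 ∧ (ι b).val = 2))) cutDist
    (T.tailGraph_connected fun u w h1 h2 h3 => ⟨h1, h2, Or.inl h3⟩) ?_ ?_ ?_ ?_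
  · obtain ⟨a, ha1, ha2⟩ := T.root_val (k := 0) (by omega)
    obtain ⟨b, hb1, hb2⟩ := T.root_val (k := 1) (by omega)
    obtain ⟨d, hd1, hd2⟩ := T.root_val (k := 2) (by omega)
    exact .of_triangle
      (tailGraph_adj_of (fun h => by subst h; omega) (Or.inl ⟨ha2, hb2, Or.inl (by omega)⟩))
      (tailGraph_adj_of (fun h => by subst h; omega) (Or.inl ⟨hb2, hd2, Or.inl (by omega)⟩))
      (tailGraph_adj_of (fun h => by subst h; omega) (Or.inr ⟨ha2, hd2, Or.inr ⟨ha1, hd1⟩⟩))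
  · intro i s; simp [cutDist]
  · intro i s j t; unfold cutDist; split_ifs <;> omega
  · rintro i s a b - ⟨h1, h2, h3⟩; unfold cutDist; rw [h1, h2]; split_ifs <;> omega

theorem sum_pend_nonpos (T : CycleTails G g ι dep) (h : G.IsEnergyMax x)
    (hr : ∃ r, (ι r).val = 1 ∧ dep r ≠ 0) :
    ∑ u, ∑ w, (((pendDist (ι u).val (dep u) (ι w).val (dep w) : ℤ) -
      cycDist g (ι u).val (dep u) (ι w).val (dep w) : ℤ) : ℝ) * (x u + x w) ^ 2 ≤ 0 := by
  have h3 := T.three_le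
  refine T.sum_nonpos_of_move h (fun a b => (dep a = 0 ∧ dep b = 0 ∧ (ι a).val + 1 = (ι b).val) ∨
    ((ι a).val = 0 ∧ dep a = 0 ∧ (ι b).val = 1 ∧ dep b = 1)) pendDist
    (T.tailGraph_connected fun u w h1 h2 h3 => Or.inl ⟨h1, h2, h3⟩) ?_ ?_ ?_ ?_
  · obtain ⟨a, ha1, ha2⟩ := T.root_val (k := 0) (by omega)
    obtain ⟨b, hb1, hb2⟩ := T.root_val (k := 1) (by omega)
    obtain ⟨r, hr1, hr2⟩ := hr
    obtain ⟨d, hd1, hd2⟩ := T.down_le r (k := 1) (by omega)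
    rw [← hd1] at hr1
    exact .of_triangle
      (tailGraph_adj_of (fun h => by subst h; omega) (Or.inl (Or.inl ⟨ha2, hb2, by omega⟩)))
      (tailGraph_adj_parent ((T.val_inj _ _).1 (by omega)) (by omega)).symm
      (tailGraph_adj_of (fun h => by subst h; omega) (Or.inr (Or.inr ⟨ha1, ha2, hr1, hd2⟩)))
  · intro i s; simp [pendDist]
  · intro i s j t; unfold pendDist; split_ifs <;> omega
  · rintro i s a b - (⟨h1, h2, h3⟩ | ⟨h1, h2, h3, h4⟩) <;> unfold pendDist
    · rw [h1, h2]; split_ifs <;> omega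
    · rw [h1, h2, h3, h4]; split_ifs <;> omega

theorem sum_deep_nonpos {ι : V → ZMod 4} (T : CycleTails G 4 ι dep) (h : G.IsEnergyMax x)
    (hr : ∃ r, (ι r).val = 1 ∧ 2 ≤ dep r) :
    ∑ u, ∑ w, (((deepDist (ι u).val (dep u) (ι w).val (dep w) : ℤ) -
      cycDist 4 (ι u).val (dep u) (ι w).val (dep w) : ℤ) : ℝ) * (x u + x w) ^ 2 ≤ 0 := by
  obtain ⟨r, hr1, hr2⟩ := hr
  obtain ⟨b, hb1, hb2⟩ := T.root_val (k := 1) (by omega)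
  obtain ⟨a, ha1, ha2⟩ := T.root_val (k := 0) (by omega)
  obtain ⟨d, hd1, hd2⟩ := T.down_le r (k := 1) (by omega)
  obtain ⟨e, he1, he2⟩ := T.down_le r (k := 2) (by omega)
  have hde : ι d = ι e := hd1.trans he1.symm
  rw [← hd1] at hr1
  have hr1' := hr1
  rw [hde] at hr1'
  refine T.sum_nonpos_of_move h (fun a b =>
    (dep a = 0 ∧ dep b = 0 ∧ (ι a).val ≠ 0 ∧ (ι a).val + 1 = (ι b).val) ∨
    ((ι a).val = 0 ∧ dep a = 0 ∧ (ι b).val = 1 ∧ (dep b = 1 ∨ dep b = 2))) deepDist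
    ?_ ?_ ?_ ?_ ?_
  · refine connected_of_rank b (fun u => dep u + (if (ι u).val = 0 then 10 else (ι u).val))
      fun u hu => ?_
    by_cases h0 : dep u = 0
    · by_cases h1 : (ι u).val = 0
      · exact ⟨d, tailGraph_adj_of (fun h => by subst h; omega)
          (Or.inl (Or.inr ⟨h1, h0, hr1, Or.inl hd2⟩)), by rw [if_pos h1, hr1]; simp; omega⟩
      · have h2 : (ι u).val ≠ 1 := fun h => hu (T.inj _ _ ((T.val_inj _ _).1 (h.trans hb1.symm))
          (h0.trans hb2.symm))
        obtain ⟨w, hw1, hw2⟩ := T.root_val (k := (ι u).val - 1) (by have := T.val_lt u; omega)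
        exact ⟨w, tailGraph_adj_of (fun h => by subst h; omega)
          (Or.inr (Or.inl ⟨hw2, h0, by omega, by omega⟩)), by split_ifs <;> omega⟩
    · obtain ⟨w, hw1, hw2⟩ := T.down u (dep u - 1) (by omega)
      exact ⟨w, tailGraph_adj_parent hw1 (by omega), by rw [hw1]; omega⟩
  · exact .of_triangle
      (tailGraph_adj_of (fun h => by subst h; omega)
        (Or.inl (Or.inr ⟨ha1, ha2, hr1, Or.inl hd2⟩)))
      (tailGraph_adj_parent hde (by omega)).symm
      (tailGraph_adj_of (fun h => by subst h; omega)
        (Or.inr (Or.inr ⟨ha1, ha2, hr1', Or.inr he2⟩)))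
  · intro i s; simp [deepDist]
  · intro i s j t; unfold deepDist; split_ifs <;> first | contradiction | omega
  · rintro i s a b hi (⟨h1, h2, h3, h4⟩ | ⟨h1, h2, h3, h4 | h4⟩) <;> unfold deepDist
    · rw [h1, h2]; split_ifs <;> first | contradiction | omega
    · rw [h1, h2, h3, h4]; split_ifs <;> first | contradiction | omega
    · rw [h1, h2, h3, h4]; split_ifs <;> first | contradiction | omega

end CycleTails

end SimpleGraph

namespace SimpleGraph

/-! ### Comparison of the distance functions -/

/-- Negation of residues modulo `g`, on representatives `i < g`. -/
def negMod (g i : ℕ) : ℕ := if i = 0 then 0 else g - i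

theorem CycleTails.neg_val {V : Type*} {G : SimpleGraph V} {g : ℕ} {ι : V → ZMod g} {dep : V → ℕ}
    (T : CycleTails G g ι dep) (a : ZMod g) : (-a).val = negMod g a.val := by
  have := T.neZero
  rw [ZMod.neg_val, negMod]
  simp [ZMod.val_eq_zero]

theorem cycDist_negMod {g i j : ℕ} (s t : ℕ) (hi : i < g) (hj : j < g) :
    cycDist g (negMod g i) s (negMod g j) t = cycDist g i s j t := by
  unfold cycDist negMod
  split_ifs <;> omega

/-- Attaching the block `0` to the path at `1` and attaching it to the path at `-1` is, in total, no
loss for any pair. -/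
theorem pendDist_add_negMod {g i j : ℕ} (s t : ℕ) (hg : 3 ≤ g) (hi : i < g) (hj : j < g) :
    2 * cycDist g i s j t ≤
      pendDist i s j t + pendDist (negMod g i) s (negMod g j) t := by
  unfold cycDist pendDist negMod
  split_ifs <;> omega

/-- The total change of the distance between the blocks `i` and `j` when the cycle is cut on either
side of the vertex `0`. -/
def cutGain (g i j : ℕ) : ℤ :=
  if i = j then 0
  else if i = 0 then (if j = 1 ∨ j + 1 = g then g - 3 else g - 2 - 2 * min (j : ℤ) (g - j))
  else if j = 0 then (if i = 1 ∨ i + 1 = g then g - 3 else g - 2 - 2 * min (i : ℤ) (g - i))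
  else 2 * max (0 : ℤ) (max (2 * (i - j) - g) (2 * (j - i) - g))

theorem cutDist_add_negMod {g i j : ℕ} (s t : ℕ) (hg : 4 ≤ g) (hi : i < g) (hj : j < g) :
    (cutDist i s j t - cycDist g i s j t : ℤ) +
      (cutDist (negMod g i) s (negMod g j) t - cycDist g (negMod g i) s (negMod g j) t : ℤ) =
      cutGain g i j := by
  rw [cycDist_negMod s t hi hj]
  unfold cycDist cutDist negMod cutGain
  rcases eq_or_ne i 0 with rfl | hi0 <;> rcases eq_or_ne j 0 with rfl | hj0
  · simp
  · simp only [hj0, hj0.symm, if_true, if_false, or_false, true_and,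
      show 0 ≠ g - j by omega, show ¬ (2 ≤ 0) by omega, and_false, zero_add]
    split_ifs <;> omega
  · simp only [hi0, if_true, if_false, false_or, true_and,
      show g - i ≠ 0 by omega, show ¬ (2 ≤ 0) by omega, and_false, zero_add]
    split_ifs <;> omega
  · simp only [hi0, hj0, or_false, if_false, false_and, show g - i ≠ 0 by omega,
      show g - j ≠ 0 by omega]
    split_ifs <;> omega

/-- On an even cycle cutting at `0` is a loss only between `0` and its antipode `h`. -/
theorem le_cutGain_even {h i j k : ℕ} (hh : 3 ≤ h) (hi : i < 2 * h) (hj : j < 2 * h)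
    (hk0 : k ≠ 0) (hk1 : k + 1 ≠ h) (hk2 : k ≠ h) (hk3 : k ≠ h + 1) :
    2 * (((if i = 0 ∧ j = k then 1 else 0) - (if i = 0 ∧ j = h then 1 else 0) +
     (if j = 0 ∧ i = k then 1 else 0) - (if j = 0 ∧ i = h then 1 else 0)) : ℤ) ≤
      cutGain (2 * h) i j := by
  unfold cutGain
  rcases eq_or_ne i 0 with rfl | hi0 <;> rcases eq_or_ne j 0 with rfl | hj0
  · simp; omega
  · simp only [hj0, hj0.symm, if_true, if_false, false_and, true_and, zero_add]
    split_ifs <;> omega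
  · simp only [hi0, if_true, if_false, false_and, true_and]
    split_ifs <;> omega
  · simp only [hi0, hj0, if_false, false_and]
    omega

/-- On an odd cycle cutting at `0` is a loss only between `0` and the two farthest vertices `m`,
`m + 1`; the pairs with shortest path `m - 1, …, 0, 2 m` of length `m` gain enough to make up for it
after summation over all rotations. -/
theorem le_cutGain_odd {m i j : ℕ} (hm : 2 ≤ m) (hi : i < 2 * m + 1) (hj : j < 2 * m + 1) :
    (2 * (if i = m - 1 ∧ j = 2 * m then 1 else 0) + 2 * (if i = 2 * m ∧ j = m - 1 then 1 else 0)
    + (if i = 0 ∧ j = 1 then 1 else 0) + (if i = 1 ∧ j = 0 then 1 else 0) 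
    - (if i = 0 ∧ j = m then 1 else 0) - (if i = m ∧ j = 0 then 1 else 0)
    - (if i = 0 ∧ j = m + 1 then 1 else 0) - (if i = m + 1 ∧ j = 0 then 1 else 0) : ℤ) ≤
      cutGain (2 * m + 1) i j := by
  unfold cutGain
  rcases eq_or_ne i 0 with rfl | hi0 <;> rcases eq_or_ne j 0 with rfl | hj0
  · simp; omega
  · simp only [hj0, hj0.symm, if_true, if_false, false_and, and_false, true_and, zero_add,
      show 0 ≠ m - 1 by omega, show 0 ≠ 2 * m by omega]
    split_ifs <;> omega
  · simp only [hi0, if_true, if_false, false_and, add_zero, and_false, and_true,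
      show 0 ≠ m - 1 by omega, show 0 ≠ 2 * m by omega]
    split_ifs <;> omega
  · simp only [hi0, hj0, if_false, false_and, and_false]
    split_ifs <;> omega

/-- If the blocks `2` and `3` of a four-cycle are trivial, attaching the block `0` to the path at `1`
and cutting the other way bring it closer to `2` and move it away from `3`, up to gains. -/
theorem le_pendDist_add_cutDist {i s j t : ℕ} (hi : i < 4) (hj : j < 4)
    (hs : i = 2 ∨ i = 3 → s = 0) (ht : j = 2 ∨ j = 3 → t = 0) :
    ((if i = 0 ∧ j = 3 then 1 else 0) - (if i = 0 ∧ j = 2 then 1 else 0) +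
      (if j = 0 ∧ i = 3 then 1 else 0) - (if j = 0 ∧ i = 2 then 1 else 0) : ℤ) ≤
    (pendDist i s j t - cycDist 4 i s j t : ℤ) +
      (cutDist (negMod 4 i) s (negMod 4 j) t - cycDist 4 (negMod 4 i) s (negMod 4 j) t : ℤ) := by
  rw [cycDist_negMod s t hi hj]
  unfold cycDist cutDist negMod pendDist
  interval_cases i <;> interval_cases j <;> simp at * <;> split_ifs <;> omega

/-- If only the block `1` of a four-cycle is nontrivial, moving the vertex `0` up the path at `1` and
twice cutting the other way is a loss only between `0` and its antipode `2`. -/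
theorem le_deepDist_add_cutDist {i s j t : ℕ} (hi : i < 4) (hj : j < 4)
    (hs : i ≠ 1 → s = 0) (ht : j ≠ 1 → t = 0) :
    (3 * (if i = 0 ∧ j = 3 then 1 else 0) - (if i = 0 ∧ j = 2 then 1 else 0) +
      3 * (if i = 0 ∧ j = 1 ∧ t = 0 then 1 else 0) +
      3 * (if j = 0 ∧ i = 3 then 1 else 0) - (if j = 0 ∧ i = 2 then 1 else 0) +
      3 * (if j = 0 ∧ i = 1 ∧ s = 0 then 1 else 0) : ℤ) ≤
    (deepDist i s j t - cycDist 4 i s j t : ℤ) +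
      2 * (cutDist (negMod 4 i) s (negMod 4 j) t -
        cycDist 4 (negMod 4 i) s (negMod 4 j) t : ℤ) := by
  rw [cycDist_negMod s t hi hj]
  unfold cycDist cutDist negMod deepDist
  interval_cases i <;> interval_cases j <;> simp at * <;> split_ifs <;>
    first | contradiction | omega

end SimpleGraph

namespace SimpleGraph

/-! ### Exchange arguments -/

variable {V : Type*} [Fintype V]

section Indicator

variable [DecidableEq V]

theorem sum_indicator_mul (P : V → Prop) [DecidablePred P] (q : V) (f : V → V → ℝ) :
    ∑ u, ∑ w, (if P u ∧ w = q then 1 else 0 : ℝ) * f u w = ∑ u, if P u then f u q else 0 := by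
  refine Finset.sum_congr rfl fun u _ => ?_
  by_cases hu : P u <;> simp [hu]

theorem sum_indicator_mul' (P : V → Prop) [DecidablePred P] (q : V) (f : V → V → ℝ)
    (hf : ∀ u w, f u w = f w u) :
    ∑ u, ∑ w, (if P w ∧ u = q then 1 else 0 : ℝ) * f u w = ∑ u, if P u then f u q else 0 := by
  rw [Finset.sum_comm, ← sum_indicator_mul]
  exact Finset.sum_congr rfl fun u _ => Finset.sum_congr rfl fun w _ => by rw [hf]

/-- If some combination of moves takes the vertices satisfying `P` away from `z` and towards `y` and
is otherwise a gain, then the Perron entry at `y` exceeds the one at `z`. -/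
theorem IsEnergyMax.lt_of_transfer {G : SimpleGraph V} {x : V → ℝ} (h : G.IsEnergyMax x)
    {E : V → V → ℤ} (hs : ∑ u, ∑ w, (E u w : ℝ) * (x u + x w) ^ 2 ≤ 0) (P : V → Prop)
    [DecidablePred P] {y z : V} {m : ℤ} (hm : 0 ≤ m)
    (hE : ∀ u w, m * ((if P u ∧ w = z then 1 else 0) - (if P u ∧ w = y then 1 else 0) +
      (if P w ∧ u = z then 1 else 0) - (if P w ∧ u = y then 1 else 0)) ≤ E u w)
    {a b : V} (hab : m * ((if P a ∧ b = z then 1 else 0) - (if P a ∧ b = y then 1 else 0) +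
      (if P b ∧ a = z then 1 else 0) - (if P b ∧ a = y then 1 else 0)) < E a b) : x z < x y := by
  by_contra! hle
  set e : V → V → ℤ := fun u w => (if P u ∧ w = z then 1 else 0) -
    (if P u ∧ w = y then 1 else 0) + (if P w ∧ u = z then 1 else 0) -
    (if P w ∧ u = y then 1 else 0) with he
  have hmono : (∑ u, if P u then (x u + x y) ^ 2 else 0) ≤
      ∑ u, if P u then (x u + x z) ^ 2 else 0 := by
    refine Finset.sum_le_sum fun u _ => ?_
    split_ifs
    · have := h.pos u
      have := h.pos y
      gcongr
    · rfl
  have h0 : 0 ≤ ∑ u, ∑ w, (e u w : ℝ) * (x u + x w) ^ 2 := by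
    have hsymm : ∀ u w, (x u + x w) ^ 2 = (x w + x u) ^ 2 := fun u w => by ring
    have e1 := sum_indicator_mul P z fun u w => (x u + x w) ^ 2
    have e2 := sum_indicator_mul P y fun u w => (x u + x w) ^ 2
    have e3 := sum_indicator_mul' P z (fun u w => (x u + x w) ^ 2) hsymm
    have e4 := sum_indicator_mul' P y (fun u w => (x u + x w) ^ 2) hsymm
    simp only [he]
    push_cast
    simp only [sub_mul, add_mul, Finset.sum_sub_distrib, Finset.sum_add_distrib]
    linarith
  refine h.false_of_nonneg_of_pos (E := fun u w => E u w - m * e u w) ?_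
    (fun u w => sub_nonneg.2 (hE u w)) (sub_pos.2 hab)
  push_cast
  simp only [sub_mul, Finset.sum_sub_distrib, mul_assoc, ← Finset.mul_sum]
  have : (0 : ℝ) ≤ m := by exact_mod_cast hm
  have := mul_nonneg this h0
  linarith

end Indicator

namespace CycleTails

variable {G : SimpleGraph V} {x : V → ℝ} {g : ℕ} {ι : V → ZMod g} {dep : V → ℕ}

/-- The sum of the energy inequalities for cutting the cycle on either side of the vertex `0`. -/
theorem sum_cutGain_nonpos (T : CycleTails G g ι dep) (h : G.IsEnergyMax x) (hg : 4 ≤ g) :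
    ∑ u, ∑ w, (cutGain g (ι u).val (ι w).val : ℝ) * (x u + x w) ^ 2 ≤ 0 := by
  have s := add_nonpos (T.sum_cut_nonpos h) (T.reflect.sum_cut_nonpos h)
  simp only [← Finset.sum_add_distrib, ← add_mul, ← Int.cast_add, T.neg_val,
    cutDist_add_negMod _ _ hg (T.val_lt _) (T.val_lt _)] at s
  exact s

/-- The two cycle neighbours of a cycle vertex do not both carry a pendant path. -/
theorem false_of_pend (T : CycleTails G g ι dep) (h : G.IsEnergyMax x) {r r' : V}
    (hr : (ι r).val = 1) (hr0 : dep r ≠ 0) (hr' : (ι r').val + 1 = g) (hr0' : dep r' ≠ 0) :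
    False := by
  have hg := T.three_le
  have s := add_nonpos (T.sum_pend_nonpos h ⟨r, hr, hr0⟩)
    (T.reflect.sum_pend_nonpos h ⟨r', by rw [T.neg_val, negMod]; split_ifs <;> omega, hr0'⟩)
  simp only [← Finset.sum_add_distrib, ← add_mul, ← Int.cast_add, T.neg_val,
    cycDist_negMod _ _ (T.val_lt _) (T.val_lt _)] at s
  obtain ⟨a, ha1, ha2⟩ := T.root_val (k := 0) (by omega)
  obtain ⟨b, hb1, hb2⟩ := T.root_val (k := 1) (by omega)
  refine h.false_of_nonneg_of_pos s (fun u w => ?_) (a := a) (b := b) ?_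
  · have := pendDist_add_negMod (dep u) (dep w) hg (T.val_lt u) (T.val_lt w)
    omega
  · rw [ha1, ha2, hb1, hb2]
    simp only [pendDist, negMod, cycDist]
    split_ifs <;> first | contradiction | omega

/-- For an even cycle of length at least six: if the blocks of `y` and `z` are trivial, and the
block of `y` is antipodal to `0` while that of `z` is none of `0`, the antipode, or a neighbour of
the antipode, then the Perron entry at `y` is larger. -/
theorem lt_of_antipodal (T : CycleTails G g ι dep) (h : G.IsEnergyMax x) {m : ℕ} (hm : 3 ≤ m)
    (hg : g = 2 * m) {y z : V} (hy : ∀ u, (ι u).val = m ↔ u = y)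
    (hz : ∀ u, (ι u).val = (ι z).val ↔ u = z) (hk0 : (ι z).val ≠ 0) (hk1 : (ι z).val + 1 ≠ m)
    (hk2 : (ι z).val ≠ m) (hk3 : (ι z).val ≠ m + 1) : x z < x y := by
  classical
  have s := T.sum_cutGain_nonpos h (by omega)
  obtain ⟨a, ha1, ha2⟩ := T.root_val (k := 0) (by omega)
  obtain ⟨b, hb1, hb2⟩ := T.root_val (k := if (ι z).val = 1 then g - 1 else 1)
    (by split_ifs <;> omega)
  refine h.lt_of_transfer s (fun u => (ι u).val = 0) (m := 2) (by norm_num) (fun u w => ?_)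
    (a := a) (b := b) ?_
  · have := le_cutGain_even hm (by rw [← hg]; exact T.val_lt u)
      (by rw [← hg]; exact T.val_lt w) hk0 hk1 hk2 hk3
    simpa only [hy, hz, ← hg] using this
  · have hbz : b ≠ z := by
      rintro rfl
      split_ifs at hb1 <;> omega
    have hby : b ≠ y := fun h => by
      have := (hy b).2 h
      split_ifs at hb1 <;> omega
    have hb0 : (ι b).val ≠ 0 := by split_ifs at hb1 <;> omega
    have hb0' : ¬ 0 = (ι b).val := hb0.symm
    have hb' : (ι b).val = 1 ∨ (ι b).val + 1 = g := by split_ifs at hb1 <;> omega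
    simp only [ha1, hbz, hby, hb0, cutGain, and_false, false_and, if_false, if_true, hb0',
      if_pos hb']
    omega

end CycleTails

end SimpleGraph

namespace SimpleGraph

/-! ### Excluding cycles of length at least four -/

variable {V : Type*} [Fintype V]

theorem sum_ite_add_eq {g : ℕ} [NeZero g] (a b p q : ZMod g) :
    ∑ s : ZMod g, (if a + s = p ∧ b + s = q then 1 else 0 : ℤ) = if b - a = q - p then 1 else 0 := by
  have : ∀ s : ZMod g, (a + s = p ∧ b + s = q) ↔ (s = p - a ∧ b - a = q - p) := by
    intro s
    constructor
    · rintro ⟨rfl, rfl⟩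
      exact ⟨by ring, by ring⟩
    · rintro ⟨rfl, h⟩
      exact ⟨by ring, by linear_combination h⟩
  simp only [this]
  by_cases h : b - a = q - p <;> simp [h]

namespace CycleTails

variable {G : SimpleGraph V} {x : V → ℝ} {g : ℕ} {ι : V → ZMod g} {dep : V → ℕ}

/-- The cycle of an energy-maximal graph is not odd of length at least five: the gains and losses
of the cuts, summed over all rotations, cancel except for a gain at each edge of the cycle. -/
theorem false_of_odd (T : CycleTails G g ι dep) (h : G.IsEnergyMax x) {m : ℕ} (hm : 2 ≤ m)
    (hg : g = 2 * m + 1) : False := by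
  have := T.neZero
  have s := Finset.sum_nonpos (s := Finset.univ) fun (s : ZMod g) _ =>
    (T.rotate s).sum_cutGain_nonpos h (by omega)
  rw [Finset.sum_comm] at s
  have hcomm : ∀ u, ∑ s : ZMod g, ∑ w, (cutGain g (ι u + s).val (ι w + s).val : ℝ) *
      (x u + x w) ^ 2 = ∑ w, ((∑ s : ZMod g, cutGain g (ι u + s).val (ι w + s).val : ℤ) : ℝ) *
      (x u + x w) ^ 2 := by
    intro u
    rw [Finset.sum_comm]
    push_cast
    simp only [Finset.sum_mul]
  simp only [hcomm] at s
  have hval : ∀ (k : ℕ), k < g → ∀ a : ZMod g, a.val = k ↔ a = (k : ZMod g) := by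
    intro k hk a
    rw [← (ZMod.val_injective g).eq_iff, ZMod.val_natCast_of_lt hk]
  have hodd : ∀ i j, i < g → j < g →
      (2 * (if i = m - 1 ∧ j = 2 * m then 1 else 0) + 2 * (if i = 2 * m ∧ j = m - 1 then 1 else 0) +
        (if i = 0 ∧ j = 1 then 1 else 0) + (if i = 1 ∧ j = 0 then 1 else 0) -
        (if i = 0 ∧ j = m then 1 else 0) - (if i = m ∧ j = 0 then 1 else 0) -
        (if i = 0 ∧ j = m + 1 then 1 else 0) - (if i = m + 1 ∧ j = 0 then 1 else 0) : ℤ) ≤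
      cutGain g i j := fun i j hi hj => by
    rw [hg] at hi hj ⊢
    exact le_cutGain_odd hm hi hj
  have hlow : ∀ u w, (if ι w - ι u = 1 then 1 else 0) + (if ι w - ι u = -1 then 1 else 0) ≤
      ∑ s : ZMod g, cutGain g (ι u + s).val (ι w + s).val := by
    intro u w
    refine le_trans (le_of_eq ?_) (Finset.sum_le_sum fun s _ =>
      hodd _ _ (ZMod.val_lt _) (ZMod.val_lt _))
    simp only [hval (m - 1) (by omega), hval (2 * m) (by omega), hval 0 (by omega),
      hval 1 (by omega), hval m (by omega), hval (m + 1) (by omega),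
      Finset.sum_sub_distrib, Finset.sum_add_distrib, ← Finset.mul_sum, sum_ite_add_eq]
    have hM : (2 * m + 1 : ZMod g) = 0 := by
      have := ZMod.natCast_self g
      rw [hg] at this ⊢
      exact_mod_cast this
    have e1 : ((2 * m : ℕ) : ZMod g) - ((m - 1 : ℕ) : ZMod g) = -m := by
      rw [Nat.cast_sub (by omega)]; push_cast; linear_combination hM
    have e2 : ((m - 1 : ℕ) : ZMod g) - ((2 * m : ℕ) : ZMod g) = m := by
      rw [Nat.cast_sub (by omega)]; push_cast; linear_combination -hM
    have e3 : ((m + 1 : ℕ) : ZMod g) - ((0 : ℕ) : ZMod g) = -m := by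
      push_cast; linear_combination hM
    have e4 : ((0 : ℕ) : ZMod g) - ((m + 1 : ℕ) : ZMod g) = m := by
      push_cast; linear_combination -hM
    rw [e1, e2, e3, e4]
    simp only [Nat.cast_zero, Nat.cast_one, sub_zero, zero_sub]
    ring
  obtain ⟨a, ha, -⟩ := T.root 0
  obtain ⟨b, hb, -⟩ := T.root 1
  refine h.false_of_nonneg_of_pos s (fun u w => le_trans ?_ (hlow u w)) (a := a) (b := b)
    (lt_of_lt_of_le ?_ (hlow a b))
  · split_ifs <;> norm_num
  · rw [ha, hb, sub_zero, if_pos rfl]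
    split_ifs <;> norm_num

/-- Of two blocks at distance two along the cycle, one is trivial. -/
theorem trivial_or_trivial (T : CycleTails G g ι dep) (h : G.IsEnergyMax x) (i : ZMod g) :
    (∀ u, ι u = i → dep u = 0) ∨ ∀ u, ι u = i + 2 → dep u = 0 := by
  by_contra! hcon
  obtain ⟨⟨r', hr', h0'⟩, r, hr, h0⟩ := hcon
  have hg := T.three_le
  have : Fact (1 < g) := ⟨by omega⟩
  refine (T.rotate (-(i + 1))).false_of_pend h (r := r) (r' := r') ?_ h0 ?_ h0'
  · rw [hr, show i + 2 + -(i + 1) = 1 by ring, ZMod.val_one]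
  · rw [hr', show i + -(i + 1) = -1 by ring, T.neg_val, ZMod.val_one, negMod, if_neg one_ne_zero]
    omega

/-- The inequality of `lt_of_antipodal` for two trivial blocks that are not equal, adjacent or
antipodal, seen from the antipode of `y`. -/
theorem lt_of_even (T : CycleTails G g ι dep) (h : G.IsEnergyMax x) {m : ℕ} (hm : 3 ≤ m)
    (hg : g = 2 * m) {y z : V} (hy : ∀ u, ι u = ι y → dep u = 0)
    (hz : ∀ u, ι u = ι z → dep u = 0) (h2 : 2 ≤ (ι z - ι y).val) (h2' : (ι z - ι y).val + 2 ≤ g)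
    (hne : (ι z - ι y).val ≠ m) : x z < x y := by
  have := T.neZero
  have hmv : ((m : ZMod g)).val = m := ZMod.val_natCast_of_lt (by omega)
  have T' := T.rotate (m - ι y)
  have hzv : (ι z + (m - ι y)).val = if m + (ι z - ι y).val < g then m + (ι z - ι y).val
      else m + (ι z - ι y).val - g := by
    rw [show ι z + (m - ι y) = m + (ι z - ι y) by ring, ZMod.val_add, hmv]
    split_ifs with hlt
    · exact Nat.mod_eq_of_lt hlt
    · rw [Nat.mod_eq_sub_mod (by omega), Nat.mod_eq_of_lt (by omega)]
  refine T'.lt_of_antipodal h hm hg (y := y) (z := z) (fun u => ?_) (fun u => ?_) ?_ ?_ ?_ ?_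
  · rw [← T.eq_of_trivial hy rfl u]
    nth_rewrite 2 [← hmv]
    rw [(ZMod.val_injective g).eq_iff]
    constructor
    · intro e; linear_combination e
    · intro e; linear_combination e
  · rw [← T.eq_of_trivial hz rfl u, (ZMod.val_injective g).eq_iff, add_left_inj]
  all_goals rw [hzv]; split_ifs <;> omega

/-- Two trivial blocks of an even cycle of length at least six are equal, adjacent or antipodal. -/
theorem not_trivial_and_trivial (T : CycleTails G g ι dep) (h : G.IsEnergyMax x) {m : ℕ}
    (hm : 3 ≤ m) (hg : g = 2 * m) (i : ZMod g) {k : ℕ} (hk : 2 ≤ k) (hk' : k + 2 ≤ g)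
    (hkm : k ≠ m) : ¬((∀ u, ι u = i → dep u = 0) ∧ ∀ u, ι u = i + k → dep u = 0) := by
  rintro ⟨hy, hz⟩
  obtain ⟨y, rfl, -⟩ := T.root i
  obtain ⟨z, hz', -⟩ := T.root (ι y + k)
  rw [← hz'] at hz
  have hv : (ι z - ι y).val = k := by
    rw [hz', add_sub_cancel_left]
    exact ZMod.val_natCast_of_lt (by omega)
  have hv' : (ι y - ι z).val = g - k := by
    rw [← neg_sub, T.neg_val, hv, negMod, if_neg (by omega)]
  exact lt_asymm (T.lt_of_even h hm hg hy hz (by omega) (by omega) (by omega))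
    (T.lt_of_even h hm hg hz hy (by omega) (by omega) (by omega))

/-- Exactly one of any two blocks at distance two is trivial, which is impossible around a six-cycle
by parity; on longer cycles two trivial blocks cannot be at distance three either. -/
theorem false_of_even (T : CycleTails G g ι dep) (h : G.IsEnergyMax x) {m : ℕ} (hm : 3 ≤ m)
    (hg : g = 2 * m) : False := by
  set P : ZMod g → Prop := fun i => ∀ u, ι u = i → dep u = 0 with hP
  have hor : ∀ i, P i ∨ P (i + 2) := T.trivial_or_trivial h
  have h2 : ∀ i, ¬(P i ∧ P (i + 2)) := fun i =>
    T.not_trivial_and_trivial h hm hg i (k := 2) le_rfl (by omega) (by omega)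
  rcases hm.eq_or_lt with rfl | hm4
  · have e : ∀ i : ZMod g, i + 2 + 2 + 2 = i := fun i => by
      subst hg
      have : (2 + 2 + 2 : ZMod (2 * 3)) = 0 := by decide
      linear_combination this
    have a1 := hor 0
    have a2 := hor (0 + 2)
    have a3 := hor (0 + 2 + 2)
    have b1 := h2 0
    have b2 := h2 (0 + 2)
    have b3 := h2 (0 + 2 + 2)
    rw [e] at a3 b3
    tauto
  · have h3 : ∀ i, ¬(P i ∧ P (i + 3)) := fun i =>
      T.not_trivial_and_trivial h hm hg i (k := 3) (by omega) (by omega) (by omega)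
    have hstep : ∀ i, P i → P (i + 1) := fun i hi => by
      have a1 := hor (i + 1)
      have a2 := h3 i
      rw [show i + 1 + 2 = i + 3 by ring] at a1
      tauto
    have hno : ∀ i, ¬P i := fun i hi => by
      have := hstep _ (hstep i hi)
      rw [show i + 1 + 1 = i + 2 by ring] at this
      exact h2 i ⟨hi, this⟩
    exact (hor 0).elim (hno _) (hno _)

section Four

variable {ι : V → ZMod 4}

/-- Next to a nontrivial block of a four-cycle, a trivial block has a larger Perron entry than the
trivial block following it. -/
theorem lt_of_four (T : CycleTails G 4 ι dep) (h : G.IsEnergyMax x) {r y z : V} (hr : dep r ≠ 0)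
    (hy : ∀ u, ι u = ι y → dep u = 0) (hz : ∀ u, ι u = ι z → dep u = 0) (hyr : ι y = ι r + 1)
    (hzr : ι z = ι r + 2) : x z < x y := by
  classical
  have T' := T.rotate (1 - ι r)
  have s := add_nonpos (T'.sum_pend_nonpos h ⟨r, by rw [add_sub_cancel]; rfl, hr⟩)
    (T'.reflect.sum_cut_nonpos h)
  simp only [← Finset.sum_add_distrib, ← add_mul, ← Int.cast_add, T.neg_val] at s
  have hyv : ∀ u, (ι u + (1 - ι r)).val = 2 ↔ u = y := fun u => by
    rw [← T.eq_of_trivial hy rfl u, hyr, show 2 = (2 : ZMod 4).val from rfl,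
      (ZMod.val_injective 4).eq_iff]
    constructor
    · intro e; linear_combination e
    · intro e; linear_combination e
  have hzv : ∀ u, (ι u + (1 - ι r)).val = 3 ↔ u = z := fun u => by
    rw [← T.eq_of_trivial hz rfl u, hzr, show 3 = (3 : ZMod 4).val from rfl,
      (ZMod.val_injective 4).eq_iff]
    constructor
    · intro e; linear_combination e
    · intro e; linear_combination e
  have htriv : ∀ u, (ι u + (1 - ι r)).val = 2 ∨ (ι u + (1 - ι r)).val = 3 → dep u = 0 := by
    intro u hu
    rcases hu with hu | hu
    · exact hy u (((hyv u).1 hu) ▸ rfl)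
    · exact hz u (((hzv u).1 hu) ▸ rfl)
  obtain ⟨a, ha1, ha2⟩ := T'.root_val (k := 0) (by omega)
  have hz3 := (hzv z).2 rfl
  have hz2 : z ≠ y := fun e => by
    have := (hyv z).2 e
    omega
  refine h.lt_of_transfer s (fun u => (ι u + (1 - ι r)).val = 0) (m := 1) (by norm_num)
    (fun u w => ?_) (a := a) (b := z) ?_
  · have := le_pendDist_add_cutDist (T'.val_lt u) (T'.val_lt w) (htriv u) (htriv w)
    simp only [hyv, hzv] at this
    rw [one_mul]
    exact this
  · rw [ha1, ha2, hz3, htriv z (Or.inr hz3)]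
    simp [hz2, pendDist, cutDist, cycDist, negMod]

/-- For a four-cycle with a single pendant path, of length at least two, the Perron entries at the
cycle neighbours of the root of the path satisfy an inequality which contradicts its mirror image,
because `(a + b)² ≤ 2 a² + 2 b²`. -/
theorem sq_lt_of_four (T : CycleTails G 4 ι dep) (h : G.IsEnergyMax x) {r a b : V}
    (hr : 2 ≤ dep r) (htriv : ∀ u, ι u ≠ ι r → dep u = 0) (ha : ι a = ι r - 1)
    (hb : ι b = ι r + 1) : 6 * x a ^ 2 < (x a + x b) ^ 2 := by
  classical
  have T' := T.rotate (1 - ι r)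
  have s := add_nonpos (T'.sum_deep_nonpos h ⟨r, by rw [add_sub_cancel]; rfl, hr⟩)
    (mul_nonpos_of_nonneg_of_nonpos (zero_le_two (α := ℝ)) (T'.reflect.sum_cut_nonpos h))
  simp only [Finset.mul_sum, ← mul_assoc, ← Finset.sum_add_distrib, ← add_mul, T.neg_val] at s
  have hval : ∀ (u : V) (k : ZMod 4), (ι u + (1 - ι r)).val = k.val ↔ ι u = ι r + (k - 1) :=
    fun u k => by
      rw [(ZMod.val_injective 4).eq_iff]
      constructor
      · intro e; linear_combination e
      · intro e; linear_combination e
  have hne : ∀ k : ZMod 4, k ≠ 1 → ∀ u, ι u = ι r + (k - 1) → dep u = 0 := by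
    intro k hk u hu
    refine htriv u fun e => hk ?_
    rw [hu] at e
    linear_combination e
  obtain ⟨d, hd, -⟩ := T.root (ι r + 2)
  obtain ⟨e, he, he0⟩ := T.root (ι r)
  have va : ∀ u, (ι u + (1 - ι r)).val = 0 ↔ u = a := fun u => by
    rw [show 0 = (0 : ZMod 4).val from rfl, hval]
    exact T.eq_of_trivial (hne 0 (by decide)) (by rw [ha]; ring) u
  have vb : ∀ u, (ι u + (1 - ι r)).val = 2 ↔ u = b := fun u => by
    rw [show 2 = (2 : ZMod 4).val from rfl, hval]
    exact T.eq_of_trivial (hne 2 (by decide)) (by rw [hb]; ring) u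
  have vd : ∀ u, (ι u + (1 - ι r)).val = 3 ↔ u = d := fun u => by
    rw [show 3 = (3 : ZMod 4).val from rfl, hval]
    exact T.eq_of_trivial (hne 3 (by decide)) (by rw [hd]; ring) u
  have ve : ∀ u, ((ι u + (1 - ι r)).val = 1 ∧ dep u = 0) ↔ u = e := fun u => by
    rw [show 1 = (1 : ZMod 4).val from rfl, hval]
    constructor
    · rintro ⟨h1, h2⟩
      exact T.inj _ _ (by rw [h1, he]; ring) (h2.trans he0.symm)
    · rintro rfl
      exact ⟨by rw [he]; ring, he0⟩
  have hsymm : ∀ u w, (x u + x w) ^ 2 = (x w + x u) ^ 2 := fun u w => by ring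
  have hT : ∀ u, (ι u + (1 - ι r)).val ≠ 1 → dep u = 0 := fun u hu => htriv u fun e => hu <| by
    rw [e, add_sub_cancel]
    rfl
  have key : ∑ u, ∑ w, ((3 * (if u = a ∧ w = d then 1 else 0) - (if u = a ∧ w = b then 1 else 0) +
      3 * (if u = a ∧ w = e then 1 else 0) + 3 * (if w = a ∧ u = d then 1 else 0) -
      (if w = a ∧ u = b then 1 else 0) + 3 * (if w = a ∧ u = e then 1 else 0) : ℤ) : ℝ) *
      (x u + x w) ^ 2 ≤ 0 := by
    refine le_trans (Finset.sum_le_sum fun u _ => Finset.sum_le_sum fun w _ =>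
      mul_le_mul_of_nonneg_right ?_ (sq_nonneg _)) s
    have := le_deepDist_add_cutDist (T'.val_lt u) (T'.val_lt w) (hT u) (hT w)
    simp only [va, vb, vd, ve] at this
    exact_mod_cast this
  push_cast at key
  simp only [sub_mul, add_mul, mul_assoc, Finset.sum_sub_distrib, Finset.sum_add_distrib,
    ← Finset.mul_sum] at key
  rw [sum_indicator_mul (· = a) d fun u w => (x u + x w) ^ 2,
    sum_indicator_mul (· = a) b fun u w => (x u + x w) ^ 2,
    sum_indicator_mul (· = a) e fun u w => (x u + x w) ^ 2,
    sum_indicator_mul' (· = a) d (fun u w => (x u + x w) ^ 2) hsymm,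
    sum_indicator_mul' (· = a) b (fun u w => (x u + x w) ^ 2) hsymm,
    sum_indicator_mul' (· = a) e (fun u w => (x u + x w) ^ 2) hsymm] at key
  simp only [Finset.sum_ite_eq', Finset.mem_univ, if_true] at key
  have pa := h.pos a
  have pd := h.pos d
  have pe := h.pos e
  nlinarith [mul_pos pa pd, mul_pos pa pe, mul_pos pd pd, mul_pos pe pe]

theorem false_of_four (T : CycleTails G 4 ι dep) (h : G.IsEnergyMax x)
    (hcard : 6 ≤ Fintype.card V) : False := by
  classical
  have hor := T.trivial_or_trivial h
  -- two adjacent nontrivial blocks are impossible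
  have hadj : ∀ r r', dep r ≠ 0 → dep r' ≠ 0 → ι r' = ι r + 1 → False := by
    intro r r' hr hr' he
    have h1 := (hor (ι r)).resolve_left fun hh => hr (hh r rfl)
    have h2 := (hor (ι r')).resolve_left fun hh => hr' (hh r' rfl)
    obtain ⟨y, hy, -⟩ := T.root (ι r + 2)
    obtain ⟨z, hz, -⟩ := T.root (ι r' + 2)
    rw [← hy] at h1
    rw [← hz] at h2
    have e4 : (4 : ZMod 4) = 0 := rfl
    refine lt_asymm (T.lt_of_four h hr' h1 h2 (by rw [hy, he]; ring) hz)
      (T.reflect.lt_of_four h (r := r) hr (fun u hu => h2 u (neg_injective hu))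
        (fun u hu => h1 u (neg_injective hu)) ?_ ?_)
    · rw [hz, he]; linear_combination -e4
    · rw [hy]; linear_combination -e4
  have huniq : ∀ r r', dep r ≠ 0 → dep r' ≠ 0 → ι r = ι r' := by
    intro r r' hr hr'
    have hcases : ∀ i j : ZMod 4, i = j ∨ j = i + 1 ∨ j = i + 2 ∨ i = j + 1 := by decide
    rcases hcases (ι r) (ι r') with h1 | h1 | h1 | h1
    · exact h1
    · exact (hadj r r' hr hr' h1).elim
    · rcases hor (ι r) with h2 | h2
      · exact absurd (h2 r rfl) hr
      · exact absurd (h2 r' h1) hr'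
    · exact (hadj r' r hr' hr h1).elim
  -- four cycle vertices and at most one vertex off the cycle are fewer than six
  obtain ⟨r, hr⟩ : ∃ r, 2 ≤ dep r := by
    by_contra! hdep
    have hinj : Function.Injective fun u => if dep u = 0 then some (ι u) else none := by
      intro u w huw
      have h1 := hdep u
      have h2 := hdep w
      by_cases hu : dep u = 0 <;> by_cases hw : dep w = 0
      · simp only [if_pos hu, if_pos hw, Option.some.injEq] at huw
        exact T.inj _ _ huw (hu.trans hw.symm)
      · simp [hu, hw] at huw
      · simp [hu, hw] at huw
      · exact T.inj _ _ (huniq u w hu hw) (by omega)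
    have := Fintype.card_le_of_injective _ hinj
    rw [Fintype.card_option, ZMod.card] at this
    omega
  have htriv : ∀ u, ι u ≠ ι r → dep u = 0 := fun u hu => by
    by_contra h0
    exact hu (huniq u r h0 (by omega))
  obtain ⟨a, ha, -⟩ := T.root (ι r - 1)
  obtain ⟨b, hb, -⟩ := T.root (ι r + 1)
  have h1 := T.sq_lt_of_four h hr htriv ha hb
  have h2 := T.reflect.sq_lt_of_four h hr (fun u hu => htriv u fun e => hu (by rw [e]))
    (a := b) (b := a) (by rw [hb]; ring) (by rw [ha]; ring)
  nlinarith [sq_nonneg (x a - x b)]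

end Four

end CycleTails

end SimpleGraph

namespace SimpleGraph

/-! ### Recognizing the kite -/

theorem Iso.dist_le {V W : Type*} {G : SimpleGraph V} {H : SimpleGraph W} (e : G ≃g H)
    (hG : G.Connected) (u w : V) : H.dist (e u) (e w) ≤ G.dist u w := by
  obtain ⟨p, hp⟩ := hG.exists_walk_length_eq_dist u w
  rw [← hp, ← Walk.length_map e.toHom p]
  exact SimpleGraph.dist_le _

theorem Iso.distanceSignlessLaplacianRadius_eq {V W : Type*} [Fintype V] [DecidableEq V]
    [Fintype W] [DecidableEq W] {G : SimpleGraph V} {H : SimpleGraph W} (e : G ≃g H)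
    (hG : G.Connected) :
    G.distanceSignlessLaplacianRadius = H.distanceSignlessLaplacianRadius := by
  have hd : ∀ u w, G.dist u w = H.dist (e u) (e w) := fun u w => by
    refine le_antisymm ?_ (e.dist_le hG u w)
    simpa using e.symm.dist_le (e.connected_iff.1 hG) (e u) (e w)
  have ht : ∀ u, G.transmission u = H.transmission (e u) := fun u => by
    simp only [transmission, hd]
    exact e.toEquiv.sum_comp fun w => (H.dist (e u) w : ℝ)
  have hQ : H.distanceSignlessLaplacian =
      Matrix.reindex e.toEquiv e.toEquiv G.distanceSignlessLaplacian := by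
    ext a b
    obtain ⟨u, rfl⟩ := e.surjective a
    obtain ⟨w, rfl⟩ := e.surjective b
    have h1 : ∀ v, e.toEquiv.symm (e v) = v := e.toEquiv.symm_apply_apply
    simp only [distanceSignlessLaplacian, Matrix.reindex_apply, Matrix.submatrix_apply, h1,
      Matrix.add_apply, distanceMatrix, Matrix.of_apply, hd, Matrix.diagonal_apply, ht,
      e.injective.eq_iff]
  have hspec : spectrum ℝ G.distanceSignlessLaplacian = spectrum ℝ H.distanceSignlessLaplacian := by
    ext r
    rw [Matrix.mem_spectrum_iff_isRoot_charpoly, Matrix.mem_spectrum_iff_isRoot_charpoly, hQ,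
      Matrix.charpoly_reindex]
  rw [distanceSignlessLaplacianRadius, distanceSignlessLaplacianRadius, hspec]

variable {V : Type*} [Fintype V] {G : SimpleGraph V}

/-- A triangle with a single pendant path is a kite: number the vertices along the path, the two
trivial vertices of the triangle coming first. -/
theorem CycleTails.nonempty_iso_kite {ι : V → ZMod 3} {dep : V → ℕ} (T : CycleTails G 3 ι dep)
    (htriv : ∀ u, (ι u).val ≠ 2 → dep u = 0) : Nonempty (G ≃g kite (Fintype.card V)) := by
  have hsurj : ∀ u k, k ≤ (ι u).val + dep u → ∃ w, (ι w).val + dep w = k := by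
    intro u k hk
    have h3 := T.val_lt u
    have ht := htriv u
    by_cases hk2 : k ≤ 2
    · obtain ⟨w, h1, h2⟩ := T.root_val (k := k) (by omega)
      exact ⟨w, by omega⟩
    · obtain ⟨w, h1, h2⟩ := T.down_le u (k := k - 2) (by omega)
      exact ⟨w, by rw [h1]; omega⟩
  have hlt : ∀ u, (ι u).val + dep u < Fintype.card V := by
    intro u
    have : Nonempty V := ⟨u⟩
    choose! w hw using hsurj u
    have hinj : Function.Injective fun k : Fin ((ι u).val + dep u + 1) => w k := by
      intro k l hkl
      have h1 := hw k (by omega)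
      have h2 := hw l (by omega)
      simp only at hkl
      rw [hkl] at h1
      exact Fin.ext (h1.symm.trans h2)
    simpa using Fintype.card_le_of_injective _ hinj
  let φ : V → Fin (Fintype.card V) := fun u => ⟨(ι u).val + dep u, hlt u⟩
  have hφ : Function.Injective φ := by
    intro u w huw
    have h1 : (ι u).val + dep u = (ι w).val + dep w := congrArg Fin.val huw
    have h2 := htriv u
    have h3 := htriv w
    have h4 := T.val_lt u
    have h5 := T.val_lt w
    have h6 : (ι u).val = (ι w).val := by omega
    exact T.inj _ _ ((T.val_inj _ _).1 h6) (by omega)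
  have hbij : Function.Bijective φ :=
    (Fintype.bijective_iff_injective_and_card φ).2 ⟨hφ, by simp⟩
  refine ⟨⟨Equiv.ofBijective φ hbij, fun {u w} => ?_⟩⟩
  have h2 := htriv u
  have h3 := htriv w
  have h4 := T.val_lt u
  have h5 := T.val_lt w
  have hsucc : ∀ a b : V, ι b = ι a + 1 ↔
      (ι b).val = if (ι a).val + 1 = 3 then 0 else (ι a).val + 1 := fun a b => by
    rw [← val_add_one_eq_ite (by omega), (ZMod.val_injective 3).eq_iff]
  rw [T.adj, ← T.val_inj, hsucc, hsucc, kite, fromRel_adj, Ne, Fin.ext_iff]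
  simp only [Equiv.ofBijective_apply, φ]
  generalize (ι u).val = a at *
  generalize (ι w).val = b at *
  split_ifs <;> omega

theorem IsEnergyMax.nonempty_iso_kite {x : V → ℝ} (h : G.IsEnergyMax x)
    (hcard : 6 ≤ Fintype.card V) : Nonempty (G ≃g kite (Fintype.card V)) := by
  obtain ⟨g, ι, dep, T⟩ := h.exists_cycleTails
  have h3 := T.three_le
  rcases Nat.even_or_odd' g with ⟨m, hm | hm⟩
  · rcases (by omega : m = 2 ∨ 3 ≤ m) with rfl | h4
    · obtain rfl : g = 4 := hm
      exact (T.false_of_four h hcard).elim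
    · exact (T.false_of_even h h4 hm).elim
  · rcases (by omega : m = 1 ∨ 2 ≤ m) with rfl | h4
    · obtain rfl : g = 3 := hm
      have hor := T.trivial_or_trivial h
      have hj : ∃ j, ∀ u, ι u ≠ j → dep u = 0 := by
        by_cases hex : ∃ r, dep r ≠ 0
        · obtain ⟨r, hr⟩ := hex
          refine ⟨ι r, fun u hu => ?_⟩
          have hcases : ∀ i j : ZMod 3, i = j ∨ i = j + 2 ∨ j = i + 2 := by decide
          rcases hcases (ι u) (ι r) with h1 | h1 | h1
          · exact absurd h1 hu
          · exact (hor (ι r)).resolve_left (fun hh => hr (hh r rfl)) u h1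
          · exact (hor (ι u)).resolve_right (fun hh => hr (hh r h1)) u rfl
        · push Not at hex
          exact ⟨0, fun u _ => hex u⟩
      obtain ⟨j, hj⟩ := hj
      refine (T.rotate (2 - j)).nonempty_iso_kite fun u hu => hj u fun e => hu ?_
      rw [e, add_sub_cancel]
      rfl
    · exact (T.false_of_odd h h4 hm).elim

end SimpleGraph

theorem mainTheorem1 {V : Type*} [Fintype V] [DecidableEq V] (n : ℕ) (hn : 6 ≤ n)
    (hV : Fintype.card V = n) (G : SimpleGraph V) (hconn : G.Connected) (huni : G.IsUnicyclic) :
    G.distanceSignlessLaplacianRadius ≤ (SimpleGraph.kite n).distanceSignlessLaplacianRadius ∧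
      (G.distanceSignlessLaplacianRadius = (SimpleGraph.kite n).distanceSignlessLaplacianRadius ↔
        Nonempty (G ≃g SimpleGraph.kite n)) := by
  subst hV
  have : Nontrivial V := Fintype.one_lt_card_iff_nontrivial.1 (by omega)
  have hcyc : G.HasCycle := by
    obtain ⟨C, ⟨v, c, hc, -⟩, -⟩ := huni
    exact hc.hasCycle
  have hkite : ∀ M : SimpleGraph V, M.Connected → M.HasCycle →
      (∀ G' : SimpleGraph V, G'.Connected → G'.HasCycle →
        G'.distanceSignlessLaplacianRadius ≤ M.distanceSignlessLaplacianRadius) →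
      Nonempty (M ≃g SimpleGraph.kite (Fintype.card V)) := fun M h1 h2 h3 => by
    obtain ⟨x, hx⟩ := M.exists_isEnergyMax h1 h2 h3
    exact hx.nonempty_iso_kite hn
  obtain ⟨M, ⟨hM1, hM2⟩, hM⟩ := Set.exists_max_image
    {G' : SimpleGraph V | G'.Connected ∧ G'.HasCycle}
    (fun G' => G'.distanceSignlessLaplacianRadius) (Set.toFinite _) ⟨G, hconn, hcyc⟩
  obtain ⟨e⟩ := hkite M hM1 hM2 fun G' h1 h2 => hM G' ⟨h1, h2⟩
  have hMk := e.distanceSignlessLaplacianRadius_eq hM1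
  refine ⟨hMk ▸ hM G ⟨hconn, hcyc⟩, fun heq => ?_, fun ⟨e'⟩ =>
    e'.distanceSignlessLaplacianRadius_eq hconn⟩
  refine hkite G hconn hcyc fun G' h1 h2 => ?_
  rw [heq, ← hMk]
  exact hM G' ⟨h1, h2⟩
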